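/- Let $\xi_0,\xi_1,\xi_2,\dots$ be mutually independent random variables with values in $\mathbb{Z}_{>0}$ such that $\xi_1,\xi_2,\dots$ (but not necessarily $\xi_0$) have a common distribution. Assume that (i) $\xi_1$ is aperiodic: $\mathrm{Prob}\{\xi_1\in N\mathbb{Z}\}<1$ for every integer $N\ge 2$; (ii) $\xi_0$ and $\xi_1$ have exponentially decaying tails: for each of $\xi=\xi_0$, $\xi=\xi_1$ there is a constant $r\in(0,1)$ such that $\mathrm{Prob}\{\xi=n\}\le r^n$ for all sufficiently large $n$. Let $\mathcal{P}$ be the delayed renewal process, that is, the law of the random set $\{S_n : n\ge 0\}\subset\mathbb{Z}_{>0}$, where $S_n=\xi_0+\xi_1+\dots+\xi_n$. Let $p_x,q_x\in[0,1]$, $x\in\mathbb{Z}_{>0}$, be arbitrary, and let $\mathcal{P}^{(p,q)}$ be the process $\mathcal{P}$ with Bernoulli noise: given the configuration $X$ drawn from $\mathcal{P}$, independently at different locations, each $x\in X$ is removed with probability $p_x$ (and kept otherwise), and at each $x\in\mathbb{Z}_{>0}\setminus X$ a new particle appears with probability $q_x$ (and the location stays empty otherwise). Then $\mathcal{P}^{(p,q)}$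 is a determinantal point process on $\mathbb{Z}_{>0}$ whose correlation kernel may be chosen so that it represents a bounded operator in $\ell^2(\mathbb{Z}_{>0})$. That is, over each of the scalar fields $\mathbb{R}$ and $\mathbb{C}$ there is a matrix $K=[K_{xy}]_{x,y\in\mathbb{Z}_{>0}}$ such that for every finite set $Y=\{y_1,\dots,y_n\}\subset\mathbb{Z}_{>0}$ $$\mathcal{P}^{(p,q)}\{X : Y\subset X\}=\det[K_{y_iy_j}]_{i,j=1}^n ,$$ and there is a bounded linear operator $T$ on $\ell^2(\mathbb{Z}_{>0})$ with $(Tf)_x=\sum_{y} K_{xy}f_y$ (convergent series) for all $f\in\ell^2(\mathbb{Z}_{>0})$ and $x\in\mathbb{Z}_{>0}$. -/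

import Mathlib

open MeasureTheory ProbabilityTheory Filter unitInterval

/-- The discrete sigma-algebra on the positive integers. -/
instance PNat.instMeasurableSpaceTop : MeasurableSpace ℕ+ := ⊤

instance PNat.instDiscreteMeasurableSpaceTop : DiscreteMeasurableSpace ℕ+ :=
  ⟨fun _ => MeasurableSpace.measurableSet_top⟩

/-! ### Determinantal point processes on a discrete space

A (simple) point process on `X` is a probability measure on `Set X`, which carries the product
sigma-algebra (generated by the events `x ∈ A`). -/

/-- `K` is a correlation kernel of the point process `P`: `P` is a probability measure and, for
every finite `Y`, the probability that the random configuration contains `Y` is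
`det [K y y']_{y, y' ∈ Y}`. -/
structure IsCorrelationKernel {X : Type*} [DecidableEq X] {𝕜 : Type*} [RCLike 𝕜]
    (P : Measure (Set X)) (K : Matrix X X 𝕜) : Prop where
  isProbabilityMeasure : IsProbabilityMeasure P
  correlation_eq_det : ∀ Y : Finset X,
    ((P.real {A : Set X | (Y : Set X) ⊆ A} : ℝ) : 𝕜) =
      (K.submatrix (fun y : Y => (y : X)) (fun y : Y => (y : X))).det

/-- The matrix `K` represents a bounded operator on `ℓ²(X)`: there is a bounded operator `T` with
`(T f) x = ∑ y, K x y * f y`, the series being convergent. -/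
def RepresentsBoundedOperator {X : Type*} {𝕜 : Type*} [RCLike 𝕜] (K : Matrix X X 𝕜) : Prop :=
  ∃ T : lp (fun _ : X => 𝕜) 2 →L[𝕜] lp (fun _ : X => 𝕜) 2,
    ∀ (f : lp (fun _ : X => 𝕜) 2) (x : X), HasSum (fun y : X => K x y * f y) (T f x)

/-! ### Bernoulli noise -/

/-- The law of the random subset of `X` containing each `x` with probability `r x`,
independently for different `x`. -/
noncomputable def independentSubset {X : Type*} (r : X → I) : Measure (Set X) :=
  (Measure.infinitePi fun x : X => bernoulliMeasure True False (r x)).map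
    fun s : X → Prop => {x : X | s x}

/-- The point process `P` with Bernoulli noise: from the configuration `A`, drawn from `P`, each
`x ∈ A` is removed with probability `p x`, and at each `x ∉ A` a new particle appears with
probability `q x`, all independently. Here `R` is the set of sites where a particle, if present,
is removed, and `B` the set of sites where a particle, if absent, is born. -/
noncomputable def bernoulliNoise {X : Type*} (P : Measure (Set X)) (p q : X → I) :
    Measure (Set X) :=
  (P.prod ((independentSubset p).prod (independentSubset q))).map
    fun (A, R, B) => (A \ R) ∪ (B \ A)

/-! ### Delayed renewal processes -/

/-- The partial sums `ξ₀ + ⋯ + ξₙ`. -/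
def renewalSum {Ω : Type*} (ξ : ℕ → Ω → ℕ+) : ℕ → Ω → ℕ+
  | 0, ω => ξ 0 ω
  | n + 1, ω => renewalSum ξ n ω + ξ (n + 1) ω

/-- `ξ₀, ξ₁, …` are mutually independent and `ξ₁, ξ₂, …` (but not necessarily `ξ₀`) have a common
distribution. -/
structure IsDelayedRenewalSequence {Ω : Type*} [MeasurableSpace Ω] (μ : Measure Ω)
    (ξ : ℕ → Ω → ℕ+) : Prop where
  measurable : ∀ n, Measurable (ξ n)
  indep : iIndepFun ξ μ
  identDistrib : ∀ n, 1 ≤ n → IdentDistrib (ξ n) (ξ 1) μ μ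

/-- The point process on `ℕ+` formed by the partial sums: the law of the random set
`{ξ₀ + ⋯ + ξₙ : n ≥ 0}`. -/
noncomputable def renewalProcess {Ω : Type*} [MeasurableSpace Ω] (μ : Measure Ω)
    (ξ : ℕ → Ω → ℕ+) : Measure (Set ℕ+) :=
  μ.map fun ω => Set.range fun n => renewalSum ξ n ω

/-- The class of random variables with exponentially decaying tails. -/
def ExponentialTails {Ω : Type*} [MeasurableSpace Ω] (μ : Measure Ω) (ξ : Ω → ℕ+) : Prop :=
  ∃ r ∈ Set.Ioo (0 : ℝ) 1, ∀ᶠ n : ℕ+ in atTop, μ.real {ω | ξ ω = n} ≤ r ^ (n : ℕ)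

/-- For every `N ≥ 2`, `ξ` is not almost surely a multiple of `N`. -/
def IsAperiodic {Ω : Type*} [MeasurableSpace Ω] (μ : Measure Ω) (ξ : Ω → ℕ+) : Prop :=
  ∀ N : ℕ, 2 ≤ N → μ.real {ω | N ∣ (ξ ω : ℕ)} < 1

/-! ### Correlation kernels and Bernoulli noise -/

/-! A renewal process regenerates at each of its points. If `h x` is the probability of visiting `x`
and `u` is the renewal sequence of the law of `ξ 1`, then points `x₁ < ⋯ < xₙ` are all visited with
probability `h x₁ * u (x₂ - x₁) * ⋯ * u (xₙ - xₙ₋₁)`. This product is the determinant of the kernel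
`h x - 1_{y < x} u (x - y)` (`IsCorrelationKernel.of_regenerative`).

That kernel does not decay above the diagonal, where its entries are `h x`. Below the diagonal it
does: by `exists_renewalSeq_sub_le`, `u` converges exponentially fast to a constant `c`, and `h`,
the convolution of the law of `ξ 0` with `u`, converges to the same `c`. Hence `h x - u (x - y)` is
of order `τ ^ (x - y)` for some `τ < 1`. Conjugation by the diagonal matrix `κ ^ (-x)` with `κ = √τ`
leaves the correlations unchanged and gives up half of this decay to create decay above the
diagonal: all entries become of order `κ ^ |x - y|` (`abs_conj_kernel_le`), and Schur's test gives
boundedness.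

The noise replaces `K` by `diag q + diag (1 - p - q) * K` (`IsCorrelationKernel.bernoulliNoise`),
which keeps the off-diagonal decay. -/

theorem Matrix.det_diagonal_add_diagonal_mul {n R : Type*} [Fintype n] [DecidableEq n] [CommRing R]
    (c d : n → R) (M : Matrix n n R) :
    (Matrix.diagonal d + Matrix.diagonal c * M).det =
      ∑ s : Finset n, ((∏ i ∈ s, c i) * ∏ i ∈ Finset.univ \ s, d i) *
        (M.submatrix (Subtype.val : s → n) (Subtype.val : s → n)).det := by
  have h : Matrix.diagonal d + Matrix.diagonal c * M =
      -- Each row is a sum of two, so multilinearity expands the determinant over the set `s` of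
      -- rows taken from `M`; the remaining rows are unit vectors and reduce it to the minor on `s`.
      Matrix.of ((fun i => c i • M.row i) + fun i => d i • (1 : Matrix n n R).row i) := by
    ext i j
    simp [Matrix.diagonal_apply, Matrix.one_apply, add_comm]
  rw [h]
  change Matrix.detRowAlternating ((fun i => c i • M.row i) +
    fun i => d i • (1 : Matrix n n R).row i) = _
  rw [AlternatingMap.map_add_univ]
  refine Finset.sum_congr rfl fun s _ => ?_
  rw [← Matrix.det_piecewise_one_eq_submatrix_det]
  have h2 : s.piecewise (fun i => c i • M.row i) (fun i => d i • (1 : Matrix n n R).row i) =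
      fun i => (if i ∈ s then c i else d i) • s.piecewise M.row (1 : Matrix n n R).row i := by
    funext i
    by_cases hi : i ∈ s <;> simp [hi]
  rw [h2, AlternatingMap.map_smul_univ, smul_eq_mul]
  congr 1
  rw [Finset.prod_ite]
  congr 2
  · simp
  · ext; simp

theorem measurableSet_finset_subset {X : Type*} (Y : Finset X) :
    MeasurableSet {A : Set X | (Y : Set X) ⊆ A} := by
  have : {A : Set X | (Y : Set X) ⊆ A} = ⋂ y ∈ Y, {A : Set X | y ∈ A} := by
    ext A; simp [Set.subset_def]
  rw [this]
  exact Finset.measurableSet_biInter _ fun y _ => measurableSet_mem y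

instance independentSubset.instIsProbabilityMeasure {X : Type*} (r : X → I) :
    IsProbabilityMeasure (independentSubset r) :=
  Measure.isProbabilityMeasure_map measurable_setOfPred.aemeasurable

theorem independentSubset_real_subset {X : Type*} (r : X → I) (S : Finset X) :
    (independentSubset r).real {B | ∀ y ∈ S, y ∈ B} = ∏ y ∈ S, (r y : ℝ) := by
  have hm : MeasurableSet {B : Set X | ∀ y ∈ S, y ∈ B} := measurableSet_finset_subset S
  rw [independentSubset, map_measureReal_apply measurable_setOfPred hm]
  have : (fun s : X → Prop => {x : X | s x}) ⁻¹' {B | ∀ y ∈ S, y ∈ B} =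
      Set.pi (S : Set X) fun _ => {True} := by
    ext s; simp [Set.mem_pi]
  rw [this, measureReal_def, Measure.infinitePi_pi _ (fun _ _ => MeasurableSet.of_discrete),
    ENNReal.toReal_prod]
  refine Finset.prod_congr rfl fun y _ => ?_
  rw [← measureReal_def]
  simp

theorem independentSubset_real_disjoint {X : Type*} (r : X → I) (S : Finset X) :
    (independentSubset r).real {B | ∀ y ∈ S, y ∉ B} = ∏ y ∈ S, (1 - (r y : ℝ)) := by
  have hm : MeasurableSet {B : Set X | ∀ y ∈ S, y ∉ B} := by
    have : {B : Set X | ∀ y ∈ S, y ∉ B} = ⋂ y ∈ S, {A : Set X | y ∉ A} := by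
      ext A; simp
    rw [this]
    exact Finset.measurableSet_biInter _ fun y _ => measurableSet_notMem y
  rw [independentSubset, map_measureReal_apply measurable_setOfPred hm]
  have : (fun s : X → Prop => {x : X | s x}) ⁻¹' {B | ∀ y ∈ S, y ∉ B} =
      Set.pi (S : Set X) fun _ => {False} := by
    ext s; simp [Set.mem_pi]
  rw [this, measureReal_def, Measure.infinitePi_pi _ (fun _ _ => MeasurableSet.of_discrete),
    ENNReal.toReal_prod]
  refine Finset.prod_congr rfl fun y _ => ?_
  rw [← measureReal_def]
  simp

theorem measurable_noise {X : Type*} :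
    Measurable fun (T : Set X × Set X × Set X) => (T.1 \ T.2.1) ∪ (T.2.2 \ T.1) := by
  rw [measurable_set_iff]
  intro a
  simp only [Set.mem_union, Set.mem_sdiff]
  have h1 : Measurable fun T : Set X × Set X × Set X => a ∈ T.1 :=
    (measurable_set_mem a).comp measurable_fst
  have h2 : Measurable fun T : Set X × Set X × Set X => a ∈ T.2.1 :=
    (measurable_set_mem a).comp (measurable_fst.comp measurable_snd)
  have h3 : Measurable fun T : Set X × Set X × Set X => a ∈ T.2.2 :=
    (measurable_set_mem a).comp (measurable_snd.comp measurable_snd)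
  exact (h1.and h2.not).or (h3.and h1.not)

/-- With `A` fixed the sites are independent: a site of `A` stays occupied with probability `1 - p`,
any other becomes occupied with probability `q`, and the affine factor interpolates between the two.
-/
theorem independentSubset_prod_real_noise {X : Type*} (p q : X → I) (Y : Finset X) (A : Set X) :
    ((independentSubset p).prod (independentSubset q)).real
      {T | (Y : Set X) ⊆ (A \ T.1) ∪ (T.2 \ A)} =
    ∏ y : Y, ((1 - p y - q y : ℝ) * A.indicator 1 (y : X) + q y) := by
  classical
  have hs : {T : Set X × Set X | (Y : Set X) ⊆ (A \ T.1) ∪ (T.2 \ A)} =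
      {R | ∀ y ∈ Y.filter (· ∈ A), y ∉ R} ×ˢ {B | ∀ y ∈ Y.filter (· ∉ A), y ∈ B} := by
    ext T
    simp only [Set.mem_ofPred_eq, Set.subset_def, Set.mem_prod, Finset.mem_filter, Finset.mem_coe,
      Set.mem_union, Set.mem_sdiff]
    constructor
    · intro h
      exact ⟨fun y hy => by have := h y hy.1; tauto, fun y hy => by have := h y hy.1; tauto⟩
    · intro h y hy
      have h1 := h.1 y
      have h2 := h.2 y
      tauto
  rw [hs, measureReal_prod_prod, independentSubset_real_disjoint, independentSubset_real_subset,
    Finset.prod_coe_sort Y fun y => ((1 - p y - q y : ℝ) * A.indicator 1 y + q y),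
    ← Finset.prod_filter_mul_prod_filter_not Y (· ∈ A)]
  congr 1
  · refine Finset.prod_congr rfl fun y hy => ?_
    simp [(Finset.mem_filter.1 hy).2]
  · refine Finset.prod_congr rfl fun y hy => ?_
    simp [(Finset.mem_filter.1 hy).2]

/-- Integrate the product of affine factors over `A`: in its expansion, the product of the
indicators over `s` is the indicator of `s ⊆ A`. The coefficients are those of
`Matrix.det_diagonal_add_diagonal_mul`. -/
theorem bernoulliNoise_real_subset {X : Type*} [DecidableEq X] (P : Measure (Set X)) [IsProbabilityMeasure P]
    (p q : X → I) (Y : Finset X) :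
    (bernoulliNoise P p q).real {A | (Y : Set X) ⊆ A} =
      ∑ s : Finset Y, ((∏ y ∈ s, (1 - p y - q y : ℝ)) * ∏ y ∈ Finset.univ \ s, (q y : ℝ)) *
        P.real {A | ((s.map (Function.Embedding.subtype _) : Finset X) : Set X) ⊆ A} := by
  have hY := measurableSet_finset_subset Y
  have hpre := measurable_noise hY
  rw [bernoulliNoise, map_measureReal_apply measurable_noise hY, measureReal_def,
    Measure.prod_apply hpre]
  have h1 : ∀ A : Set X, ((independentSubset p).prod (independentSubset q))
      (Prod.mk A ⁻¹' ((fun T : Set X × Set X × Set X => (T.1 \ T.2.1) ∪ (T.2.2 \ T.1)) ⁻¹'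
        {A | (Y : Set X) ⊆ A})) =
      ENNReal.ofReal (∏ y : Y, ((1 - p y - q y : ℝ) * A.indicator 1 (y : X) + q y)) := by
    intro A
    rw [← independentSubset_prod_real_noise, ofReal_measureReal]
    rfl
  simp_rw [h1]
  have h2 : ∀ A : Set X, ∏ y : Y, ((1 - p y - q y : ℝ) * A.indicator 1 (y : X) + q y) =
      ∑ s : Finset Y, ((∏ y ∈ s, (1 - p y - q y : ℝ)) * ∏ y ∈ Finset.univ \ s, (q y : ℝ)) *
        {A : Set X | ((s.map (Function.Embedding.subtype _) : Finset X) : Set X) ⊆ A}.indicator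
          1 A := by
    intro A
    rw [Finset.prod_add, Finset.powerset_univ]
    refine Finset.sum_congr rfl fun s _ => ?_
    rw [Finset.prod_mul_distrib, mul_right_comm]
    congr 1
    by_cases h : ((s.map (Function.Embedding.subtype _) : Finset X) : Set X) ⊆ A
    · rw [Set.indicator_of_mem h]
      refine Finset.prod_eq_one fun y hy => ?_
      have : (y : X) ∈ A := h (by simpa using hy)
      simp [this]
    · rw [Set.indicator_of_notMem h]
      obtain ⟨y, hy, hyA⟩ := Set.not_subset.1 h
      obtain ⟨z, hz, rfl⟩ := Finset.mem_map.1 (Finset.mem_coe.1 hy)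
      refine Finset.prod_eq_zero hz ?_
      rw [Set.indicator_of_notMem (by simpa using hyA)]
  have h0 : ∀ A : Set X, 0 ≤ ∏ y : Y, ((1 - p y - q y : ℝ) * A.indicator 1 (y : X) + q y) :=
    fun A => by rw [← independentSubset_prod_real_noise]; positivity
  have hm : ∀ s : Finset Y, Integrable
      ({A : Set X | ((s.map (Function.Embedding.subtype _) : Finset X) : Set X) ⊆ A}.indicator
        (1 : Set X → ℝ)) P := fun s =>
    (integrable_indicator_iff (measurableSet_finset_subset _)).2 (integrable_const 1).integrableOn
  have hi : Integrable (fun A : Set X =>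
      ∏ y : Y, ((1 - p y - q y : ℝ) * A.indicator 1 (y : X) + q y)) P := by
    simp_rw [h2]
    exact integrable_finsetSum _ fun s _ => (hm s).const_mul _
  rw [← integral_eq_lintegral_of_nonneg_ae (Eventually.of_forall h0) hi.aestronglyMeasurable]
  simp_rw [h2]
  rw [integral_finsetSum _ fun s _ => (hm s).const_mul _]
  refine Finset.sum_congr rfl fun s _ => ?_
  rw [integral_const_mul, integral_indicator_one (measurableSet_finset_subset _)]

/-- Bernoulli noise turns a determinantal process into a determinantal process. -/
theorem IsCorrelationKernel.bernoulliNoise {X : Type*} [DecidableEq X] {𝕜 : Type*} [RCLike 𝕜]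
    {P : Measure (Set X)} {K : Matrix X X 𝕜} (hK : IsCorrelationKernel P K) (p q : X → I) :
    IsCorrelationKernel (bernoulliNoise P p q)
      (Matrix.of fun x y => (if x = y then ((q x : ℝ) : 𝕜) else 0) +
        ((1 - p x - q x : ℝ) : 𝕜) * K x y) := by
  have := hK.isProbabilityMeasure
  refine ⟨Measure.isProbabilityMeasure_map measurable_noise.aemeasurable, fun Y => ?_⟩
  have h : (Matrix.of fun x y => (if x = y then ((q x : ℝ) : 𝕜) else 0) +
        ((1 - p x - q x : ℝ) : 𝕜) * K x y).submatrix (fun y : Y => (y : X))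
          (fun y : Y => (y : X)) =
      Matrix.diagonal (fun y : Y => ((q y : ℝ) : 𝕜)) +
        Matrix.diagonal (fun y : Y => ((1 - p y - q y : ℝ) : 𝕜)) *
          K.submatrix (fun y : Y => (y : X)) (fun y : Y => (y : X)) := by
    ext i j
    rw [Matrix.add_apply, Matrix.diagonal_mul, Matrix.diagonal_apply]
    simp only [Matrix.submatrix_apply, Matrix.of_apply, Subtype.ext_iff]
  rw [h, Matrix.det_diagonal_add_diagonal_mul, bernoulliNoise_real_subset, RCLike.ofReal_sum]
  refine Finset.sum_congr rfl fun s _ => ?_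
  rw [RCLike.ofReal_mul, hK.correlation_eq_det, RCLike.ofReal_mul, RCLike.ofReal_prod,
    RCLike.ofReal_prod]
  congr 1
  let e : s ≃ (s.map (Function.Embedding.subtype _) : Finset X) :=
    { toFun := fun y => ⟨y.1.1, Finset.mem_map_of_mem (Function.Embedding.subtype _) y.2⟩
      invFun := fun y => ⟨⟨y.1, by
          obtain ⟨z, _, hz⟩ := Finset.mem_map.1 y.2
          exact hz ▸ z.2⟩, by
          obtain ⟨z, hs, hz⟩ := Finset.mem_map.1 y.2
          have : z = ⟨y.1, hz ▸ z.2⟩ := Subtype.ext hz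
          exact this ▸ hs⟩
      left_inv := fun y => rfl
      right_inv := fun y => rfl }
  rw [← Matrix.det_submatrix_equiv_self e]
  rfl

/-! ### Matrices representing bounded operators -/

theorem lp.summable_norm_sq {X 𝕜 : Type*} [RCLike 𝕜] (f : lp (fun _ : X => 𝕜) 2) :
    Summable fun x => ‖f x‖ ^ 2 := by
  simpa using (lp.memℓp f).summable (by simp)

theorem lp.tsum_norm_sq {X 𝕜 : Type*} [RCLike 𝕜] (f : lp (fun _ : X => 𝕜) 2) :
    ∑' x, ‖f x‖ ^ 2 = ‖f‖ ^ 2 := by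
  simpa using (lp.norm_rpow_eq_tsum (p := 2) (by simp) f).symm

/-- Schur's test. -/
theorem RepresentsBoundedOperator.of_schur {X 𝕜 : Type*} [RCLike 𝕜] (K : Matrix X X 𝕜) {A : ℝ}
    (hrow : ∀ x, Summable fun y => ‖K x y‖) (hrow' : ∀ x, ∑' y, ‖K x y‖ ≤ A)
    (hcol : ∀ y, Summable fun x => ‖K x y‖) (hcol' : ∀ y, ∑' x, ‖K x y‖ ≤ A) :
    RepresentsBoundedOperator K := by
  rcases isEmpty_or_nonempty X with hX | ⟨⟨x₀⟩⟩
  · exact ⟨0, fun f x => hX.elim x⟩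
  have hA : 0 ≤ A := (tsum_nonneg fun y => norm_nonneg _).trans (hrow' x₀)
  have hKf2 : ∀ (f : lp (fun _ : X => 𝕜) 2) x, Summable fun y => ‖K x y‖ * ‖f y‖ ^ 2 := by
    intro f x
    refine Summable.of_nonneg_of_le (fun y => by positivity)
      (fun y => mul_le_mul_of_nonneg_left
        (pow_le_pow_left₀ (norm_nonneg _) (lp.norm_apply_le_norm two_ne_zero f y) 2)
        (norm_nonneg _)) ((hrow x).mul_right _)
  have hKf : ∀ (f : lp (fun _ : X => 𝕜) 2) x, Summable fun y => ‖K x y * f y‖ := by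
    intro f x
    refine Summable.of_nonneg_of_le (fun y => by positivity)
      (fun y => ?_) ((hrow x).mul_right ‖f‖)
    rw [norm_mul]
    exact mul_le_mul_of_nonneg_left (lp.norm_apply_le_norm two_ne_zero f y) (norm_nonneg _)
  -- Cauchy–Schwarz for the weights `‖K x y‖`, on partial sums and then in the limit.
  have hcs : ∀ (f : lp (fun _ : X => 𝕜) 2) x,
      ‖∑' y, K x y * f y‖ ^ 2 ≤ A * ∑' y, ‖K x y‖ * ‖f y‖ ^ 2 := by
    intro f x
    have h1 : ‖∑' y, K x y * f y‖ ≤ ∑' y, ‖K x y * f y‖ := norm_tsum_le_tsum_norm (hKf f x)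
    have h2 : (∑' y, ‖K x y * f y‖) ^ 2 ≤ A * ∑' y, ‖K x y‖ * ‖f y‖ ^ 2 := by
      have ht : Tendsto (fun s : Finset X => (∑ y ∈ s, ‖K x y * f y‖) ^ 2) atTop
          (nhds ((∑' y, ‖K x y * f y‖) ^ 2)) := (hKf f x).hasSum.pow 2
      refine le_of_tendsto ht (Eventually.of_forall fun s => ?_)
      calc (∑ y ∈ s, ‖K x y * f y‖) ^ 2
          ≤ (∑ y ∈ s, ‖K x y‖) * ∑ y ∈ s, ‖K x y‖ * ‖f y‖ ^ 2 := by
            refine Finset.sum_sq_le_sum_mul_sum_of_sq_le_mul s (fun i _ => norm_nonneg _)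
              (fun i _ => by positivity) fun i _ => ?_
            rw [norm_mul, mul_pow, sq, mul_assoc]
        _ ≤ A * ∑' y, ‖K x y‖ * ‖f y‖ ^ 2 := by
            refine mul_le_mul (((hrow x).sum_le_tsum s fun i _ => norm_nonneg _).trans (hrow' x))
              ((hKf2 f x).sum_le_tsum s fun i _ => by positivity)
              (Finset.sum_nonneg fun i _ => by positivity) hA
    exact (pow_le_pow_left₀ (norm_nonneg _) h1 2).trans h2
  have hfin : ∀ (f : lp (fun _ : X => 𝕜) 2) (s : Finset X),
      ∑ x ∈ s, ‖∑' y, K x y * f y‖ ^ 2 ≤ (A * ‖f‖) ^ 2 := by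
    intro f s
    calc ∑ x ∈ s, ‖∑' y, K x y * f y‖ ^ 2
        ≤ ∑ x ∈ s, A * ∑' y, ‖K x y‖ * ‖f y‖ ^ 2 := Finset.sum_le_sum fun x _ => hcs f x
      _ = A * ∑' y, (∑ x ∈ s, ‖K x y‖) * ‖f y‖ ^ 2 := by
          rw [← Finset.mul_sum, ← Summable.tsum_finsetSum fun x _ => hKf2 f x]
          simp_rw [Finset.sum_mul]
      _ ≤ A * ∑' y, A * ‖f y‖ ^ 2 := by
          have hle : ∀ y, (∑ x ∈ s, ‖K x y‖) * ‖f y‖ ^ 2 ≤ A * ‖f y‖ ^ 2 := fun y =>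
            mul_le_mul_of_nonneg_right (((hcol y).sum_le_tsum s fun i _ => norm_nonneg _).trans
              (hcol' y)) (by positivity)
          have hs := (lp.summable_norm_sq f).mul_left A
          exact mul_le_mul_of_nonneg_left (Summable.tsum_le_tsum hle
            (Summable.of_nonneg_of_le (fun y => mul_nonneg
              (Finset.sum_nonneg fun i _ => norm_nonneg _) (by positivity)) hle hs) hs) hA
      _ = (A * ‖f‖) ^ 2 := by rw [tsum_mul_left, lp.tsum_norm_sq]; ring
  let T : lp (fun _ : X => 𝕜) 2 →ₗ[𝕜] lp (fun _ : X => 𝕜) 2 :=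
    { toFun := fun f => ⟨fun x => ∑' y, K x y * f y,
        memℓp_gen' (C := (A * ‖f‖) ^ 2) fun s => by simpa using hfin f s⟩
      map_add' := fun f g => by
        ext x
        simp only [lp.coeFn_add, Pi.add_apply, mul_add]
        exact (hKf f x).of_norm.tsum_add (hKf g x).of_norm
      map_smul' := fun c f => by
        ext x
        simp only [lp.coeFn_smul, Pi.smul_apply, smul_eq_mul, RingHom.id_apply]
        rw [← tsum_mul_left]
        exact tsum_congr fun y => by ring }
  refine ⟨T.mkContinuous A fun f => ?_, fun f x => (hKf f x).of_norm.hasSum⟩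
  refine lp.norm_le_of_forall_sum_le (by simp) (by positivity) fun s => ?_
  have hT : ∀ x, (T f) x = ∑' y, K x y * f y := fun _ => rfl
  simpa [hT] using hfin f s

/-- A matrix whose entries decay exponentially away from the diagonal is bounded. -/
theorem RepresentsBoundedOperator.of_exponential_decay {𝕜 : Type*} [RCLike 𝕜]
    (K : Matrix ℕ+ ℕ+ 𝕜) {C ρ : ℝ} (hρ0 : 0 ≤ ρ) (hρ1 : ρ < 1)
    (hK : ∀ x y, ‖K x y‖ ≤ C * ρ ^ ((x : ℤ) - (y : ℤ)).natAbs) :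
    RepresentsBoundedOperator K := by
  have hC : 0 ≤ C := by
    have := (norm_nonneg _).trans (hK 1 1)
    simpa using this
  have hs : Summable fun k : ℤ => C * ρ ^ k.natAbs := by
    refine Summable.mul_left C (Summable.of_nat_of_neg ?_ ?_)
    · simpa using summable_geometric_of_lt_one hρ0 hρ1
    · simpa using summable_geometric_of_lt_one hρ0 hρ1
  -- Along a row or a column the difference `x - y` is injective, so one sum over `ℤ` bounds both.
  have key : ∀ (g : ℕ+ → ℤ), Function.Injective g → ∀ (F : ℕ+ → 𝕜),
      (∀ y, ‖F y‖ ≤ C * ρ ^ (g y).natAbs) → (Summable fun y => ‖F y‖) ∧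
        ∑' y, ‖F y‖ ≤ ∑' k : ℤ, C * ρ ^ k.natAbs := by
    intro g hg F hF
    have h1 : Summable fun y => C * ρ ^ (g y).natAbs := hs.comp_injective hg
    have h2 := Summable.of_nonneg_of_le (fun y => norm_nonneg _) hF h1
    exact ⟨h2, (h2.tsum_le_tsum hF h1).trans
      (tsum_comp_le_tsum_of_inj hs (fun k => by positivity) hg)⟩
  have hr := fun x : ℕ+ => key (fun y => (x : ℤ) - y)
    (fun a b h => by simpa using h) (fun y => K x y) (hK x)
  have hc := fun y : ℕ+ => key (fun x => (x : ℤ) - y)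
    (fun a b h => by simpa using h) (fun x => K x y) (fun x => hK x y)
  exact RepresentsBoundedOperator.of_schur K (fun x => (hr x).1) (fun x => (hr x).2)
    (fun y => (hc y).1) (fun y => (hc y).2)

/-! ### The renewal theorem with exponential rate of convergence -/

/-- The renewal sequence of `f`: the coefficients of `1 / (1 - ∑ f n X ^ n)`. -/
noncomputable def renewalSeq (f : ℕ → ℝ) (n : ℕ) : ℝ :=
  PowerSeries.coeff n (1 - PowerSeries.mk f)⁻¹

/-- The tails of the series `f` of sum `1`. -/
noncomputable def tailSeq (f : ℕ → ℝ) (n : ℕ) : ℝ := 1 - ∑ k ∈ Finset.range (n + 1), f k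

theorem renewalSeq_series (f : ℕ → ℝ) (h0 : f 0 = 0) :
    (1 - PowerSeries.mk f) * PowerSeries.mk (renewalSeq f) = 1 := by
  have : PowerSeries.mk (renewalSeq f) = (1 - PowerSeries.mk f)⁻¹ := by
    ext n; simp [renewalSeq]
  rw [this]
  exact PowerSeries.mul_inv_cancel _ (by simp [h0])

theorem renewalSeq_zero (f : ℕ → ℝ) (h0 : f 0 = 0) : renewalSeq f 0 = 1 := by
  have := congrArg (PowerSeries.coeff 0) (renewalSeq_series f h0)
  simpa [h0] using this

theorem renewalSeq_recurrence (f : ℕ → ℝ) (h0 : f 0 = 0) {n : ℕ} (hn : n ≠ 0) :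
    renewalSeq f n = ∑ a ∈ Finset.HasAntidiagonal.antidiagonal n, f a.1 * renewalSeq f a.2 := by
  have := congrArg (PowerSeries.coeff n) (renewalSeq_series f h0)
  rw [sub_mul, one_mul, map_sub, PowerSeries.coeff_mul, PowerSeries.coeff_one, if_neg hn] at this
  simp only [PowerSeries.coeff_mk] at this
  linarith

/-- The differences of the tails telescope back to `f`. Passing to the tails divides out the zero of
`1 - ∑ f n z ^ n` at `z = 1`. -/
theorem tailSeq_series (f : ℕ → ℝ) :
    (1 - PowerSeries.X) * PowerSeries.mk (tailSeq f) = 1 - PowerSeries.mk f := by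
  ext n
  rw [sub_mul, one_mul]
  cases n with
  | zero => simp [tailSeq]
  | succ n =>
    simp [PowerSeries.coeff_succ_X_mul, PowerSeries.coeff_one, tailSeq,
      Finset.sum_range_succ _ (n + 1)]

theorem renewalSeq_mem_Icc {f : ℕ → ℝ} (h0 : f 0 = 0) (hf : ∀ n, 0 ≤ f n) (h1 : HasSum f 1)
    (n : ℕ) : renewalSeq f n ∈ Set.Icc (0 : ℝ) 1 := by
  induction n using Nat.strong_induction_on with
  | _ n ih =>
    rcases eq_or_ne n 0 with rfl | hn
    · simp [renewalSeq_zero f h0]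
    rw [renewalSeq_recurrence f h0 hn]
    have hb : ∀ a ∈ Finset.HasAntidiagonal.antidiagonal n, 0 ≤ f a.1 * renewalSeq f a.2 ∧
        f a.1 * renewalSeq f a.2 ≤ f a.1 := by
      intro a ha
      rcases eq_or_ne a.1 0 with h | h
      · simp [h, h0]
      have := ih a.2 (by have := Finset.HasAntidiagonal.mem_antidiagonal.1 ha; omega)
      exact ⟨mul_nonneg (hf _) this.1, mul_le_of_le_one_right (hf _) this.2⟩
    refine ⟨Finset.sum_nonneg fun a ha => (hb a ha).1, ?_⟩
    refine (Finset.sum_le_sum fun a ha => (hb a ha).2).trans ?_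
    rw [Finset.Nat.sum_antidiagonal_eq_sum_range_succ_mk]
    exact sum_le_hasSum _ (fun i _ => hf i) h1

theorem tailSeq_bound {f : ℕ → ℝ} (h1 : HasSum f 1) (hf : ∀ n, 0 ≤ f n) {C r : ℝ}
    (hr0 : 0 ≤ r) (hr : r < 1) (hfr : ∀ n, f n ≤ C * r ^ n) (n : ℕ) :
    0 ≤ tailSeq f n ∧ tailSeq f n ≤ C / (1 - r) * r ^ n := by
  have ht : tailSeq f n = ∑' k, f (k + (n + 1)) := by
    rw [tailSeq, ← h1.tsum_eq, ← h1.summable.sum_add_tsum_nat_add (n + 1)]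
    ring
  have hC : 0 ≤ C := by simpa using (hf 0).trans (hfr 0)
  rw [ht]
  refine ⟨tsum_nonneg fun k => hf _, ?_⟩
  have hg : HasSum (fun k : ℕ => C * r ^ n * r ^ k) (C * r ^ n * (1 - r)⁻¹) :=
    (hasSum_geometric_of_lt_one hr0 hr).mul_left _
  have hle : ∀ k, f (k + (n + 1)) ≤ C * r ^ n * r ^ k := fun k => by
    refine (hfr _).trans ?_
    rw [mul_assoc, ← pow_add]
    exact mul_le_mul_of_nonneg_left (pow_le_pow_of_le_one hr0 hr.le (by omega)) hC
  have hs : Summable fun k => f (k + (n + 1)) := (summable_nat_add_iff (n + 1)).2 h1.summable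
  refine (hs.tsum_le_tsum hle hg.summable).trans (le_of_eq ?_)
  rw [hg.tsum_eq]
  ring

/-- Equality case of the triangle inequality: `∑ f n * (1 - Re (z ^ n)) = 0` has nonnegative terms,
so `Re (z ^ n) = 1` on the support of `f`, and `‖z ^ n‖ ≤ 1` leaves no imaginary part. -/
theorem eq_one_of_tsum_mul_pow_eq_one {f : ℕ → ℝ} (hf : ∀ n, 0 ≤ f n) (h1 : HasSum f 1) {z : ℂ}
    (hz : ‖z‖ ≤ 1) (hfz : ∑' n, (f n : ℂ) * z ^ n = 1) {n : ℕ} (hn : f n ≠ 0) : z ^ n = 1 := by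
  have hs : Summable fun n => (f n : ℂ) * z ^ n := by
    refine Summable.of_norm_bounded h1.summable fun n => ?_
    rw [norm_mul, norm_pow, Complex.norm_real, Real.norm_of_nonneg (hf n)]
    exact mul_le_of_le_one_right (hf n) (pow_le_one₀ (norm_nonneg _) hz)
  have hre : HasSum (fun n => f n * (1 - (z ^ n).re)) 0 := by
    have h2 := Complex.hasSum_re (hfz ▸ hs.hasSum)
    have h3 := h1.sub h2
    simp only [Complex.one_re, sub_self, Complex.re_ofReal_mul] at h3
    simpa [mul_sub] using h3
  have hle : ∀ n, (z ^ n).re ≤ 1 := fun n =>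
    (Complex.re_le_norm _).trans (by rw [norm_pow]; exact pow_le_one₀ (norm_nonneg _) hz)
  have h4 := (hasSum_zero_iff_of_nonneg fun n =>
    mul_nonneg (hf n) (sub_nonneg.2 (hle n))).1 hre
  have h5 : (z ^ n).re = 1 := by
    have := congrFun h4 n
    have := (mul_eq_zero.1 this).resolve_left hn
    linarith
  have h6 : ‖z ^ n‖ ≤ 1 := by rw [norm_pow]; exact pow_le_one₀ (norm_nonneg _) hz
  have h7 : (z ^ n).re ^ 2 + (z ^ n).im ^ 2 ≤ 1 := by
    have := Complex.sq_norm (z ^ n)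
    rw [Complex.normSq_apply] at this
    nlinarith [norm_nonneg (z ^ n)]
  rw [h5] at h7
  have h8 : (z ^ n).im = 0 := by nlinarith [sq_nonneg (z ^ n).im]
  exact Complex.ext h5 h8

theorem summable_mul_pow_of_le {t : ℕ → ℝ} {C r : ℝ} (hr : r < 1)
    (hr0 : 0 ≤ r) (ht : ∀ n, ‖t n‖ ≤ C * r ^ n) {z : ℂ} (hz : ‖z‖ ≤ 1) :
    Summable fun n => ‖(t n : ℂ) * z ^ n‖ := by
  refine Summable.of_nonneg_of_le (fun n => norm_nonneg _) (fun n => ?_)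
    ((summable_geometric_of_lt_one hr0 hr).mul_left C)
  rw [norm_mul, norm_pow, Complex.norm_real]
  exact (mul_le_of_le_one_right (norm_nonneg _) (pow_le_one₀ (norm_nonneg _) hz)).trans (ht n)

/-- At a zero, `∑ f n z ^ n = 1`, so `z ^ n = 1` on the support of `f` and the order of `z` divides
the whole support, against aperiodicity. The point `z = 1` is separate: there the sum is at least
`tailSeq f 0 = 1`. -/
theorem tsum_tailSeq_ne_zero {f : ℕ → ℝ} (h0 : f 0 = 0) (hf : ∀ n, 0 ≤ f n) (h1 : HasSum f 1)
    (hap : ∀ N : ℕ, 2 ≤ N → ∃ n, f n ≠ 0 ∧ ¬ N ∣ n) {C r : ℝ}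
    (hr0 : 0 ≤ r) (hr : r < 1) (hfr : ∀ n, f n ≤ C * r ^ n) {z : ℂ} (hz : ‖z‖ ≤ 1) :
    ∑' n, (tailSeq f n : ℂ) * z ^ n ≠ 0 := by
  have htb := tailSeq_bound h1 hf hr0 hr hfr
  have hts : Summable fun n => (tailSeq f n : ℂ) * z ^ n :=
    (summable_mul_pow_of_le hr hr0 (fun n => by
      rw [Real.norm_of_nonneg (htb n).1]; exact (htb n).2) hz).of_norm
  have hfs : Summable fun n => (f n : ℂ) * z ^ n :=
    (summable_mul_pow_of_le hr hr0 (fun n => by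
      rw [Real.norm_of_nonneg (hf n)]; exact hfr n) hz).of_norm
  have ht0 : tailSeq f 0 = 1 := by simp [tailSeq, h0]
  have hmul : (1 - z) * ∑' n, (tailSeq f n : ℂ) * z ^ n = 1 - ∑' n, (f n : ℂ) * z ^ n := by
    have hts' : Summable fun n => (tailSeq f (n + 1) : ℂ) * z ^ (n + 1) :=
      (summable_nat_add_iff 1).2 hts
    rw [sub_mul, one_mul, ← tsum_mul_left, hts.tsum_eq_zero_add, hfs.tsum_eq_zero_add, h0, ht0]
    have : ∑' n, (f (n + 1) : ℂ) * z ^ (n + 1) =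
        ∑' n, z * ((tailSeq f n : ℂ) * z ^ n) -
          ∑' n, (tailSeq f (n + 1) : ℂ) * z ^ (n + 1) := by
      rw [← (hts.mul_left z).tsum_sub hts']
      refine tsum_congr fun n => ?_
      have : f (n + 1) = tailSeq f n - tailSeq f (n + 1) := by
        simp [tailSeq, Finset.sum_range_succ _ (n + 1)]
      rw [this]
      push_cast
      ring
    rw [this]
    simp only [Complex.ofReal_one, pow_zero, Complex.ofReal_zero]
    ring
  intro hT
  rw [hT, mul_zero, eq_comm, sub_eq_zero] at hmul
  have hpow : ∀ n, f n ≠ 0 → z ^ n = 1 := fun n hn =>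
    eq_one_of_tsum_mul_pow_eq_one hf h1 hz hmul.symm hn
  have hz1 : z ≠ 1 := by
    rintro rfl
    simp only [one_pow, mul_one] at hT
    rw [← Complex.ofReal_tsum] at hT
    have hT' : ∑' n, tailSeq f n = 0 := by exact_mod_cast hT
    have hts1 : Summable (tailSeq f) := by
      rw [← Complex.summable_ofReal]
      simpa using hts
    have := hts1.le_tsum 0 fun n _ => (htb n).1
    rw [hT', ht0] at this
    linarith
  have hN : orderOf z ≠ 1 := fun h => hz1 (orderOf_eq_one_iff.1 h)
  obtain ⟨m, hm⟩ : ∃ m, f m ≠ 0 := by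
    by_contra! h
    have := h1.tsum_eq
    simp [h] at this
  have hm0 : m ≠ 0 := fun h => hm (h ▸ h0)
  -- Excludes the default value `0` of `orderOf`, so that the order is at least `2` and aperiodicity
  -- applies.
  have hpos : 0 < orderOf z :=
    orderOf_pos_iff.2 (isOfFinOrder_iff_pow_eq_one.2 ⟨m, Nat.pos_of_ne_zero hm0, hpow m hm⟩)
  obtain ⟨n, hn, hd⟩ := hap (orderOf z) (by omega)
  exact hd (orderOf_dvd_of_pow_eq_one (hpow n hn))

theorem FormalMultilinearSeries.le_radius_ofScalars_of_bound {t : ℕ → ℂ} {C : ℝ} {s : NNReal}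
    (h : ∀ n, ‖t n‖ * (s : ℝ) ^ n ≤ C) :
    (s : ENNReal) ≤ (FormalMultilinearSeries.ofScalars ℂ t).radius :=
  FormalMultilinearSeries.le_radius_of_bound _ C fun n => by
    rw [FormalMultilinearSeries.ofScalars_norm]; exact h n

theorem ofScalars_sum_apply (t : ℕ → ℂ) (z : ℂ) :
    (FormalMultilinearSeries.ofScalars ℂ t).sum z = ∑' n, t n * z ^ n := by
  simp [FormalMultilinearSeries.sum, mul_comm]

/-- If a power series converging beyond the unit disc has no zero in the closed unit disc, then the
coefficients of its inverse, if bounded, decay exponentially. -/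
theorem exists_exponential_decay_of_mul_eq_one {t d : ℕ → ℝ}
    (htd : PowerSeries.mk t * PowerSeries.mk d = 1) {C D r : ℝ} (hr0 : 0 < r) (hr : r < 1)
    (ht : ∀ n, ‖t n‖ ≤ C * r ^ n) (hd : ∀ n, ‖d n‖ ≤ D)
    (hne : ∀ z : ℂ, ‖z‖ ≤ 1 → ∑' n, (t n : ℂ) * z ^ n ≠ 0) :
    ∃ ρ ∈ Set.Ioo (0 : ℝ) 1, ∃ B, ∀ n, |d n| ≤ B * ρ ^ n := by
  set p := FormalMultilinearSeries.ofScalars ℂ fun n => (t n : ℂ) with hp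
  set q := FormalMultilinearSeries.ofScalars ℂ fun n => (d n : ℂ) with hq
  have hpr : ENNReal.ofReal r⁻¹ ≤ p.radius := by
    refine FormalMultilinearSeries.le_radius_ofScalars_of_bound (C := C) fun n => ?_
    rw [Real.coe_toNNReal _ (by positivity), Complex.norm_real, inv_pow, ← div_eq_mul_inv,
      div_le_iff₀ (by positivity)]
    exact ht n
  have hqr : ((1 : NNReal) : ENNReal) ≤ q.radius :=
    FormalMultilinearSeries.le_radius_ofScalars_of_bound (C := D) fun n => by
      simpa using hd n
  have hr1 : 1 < r⁻¹ := (one_lt_inv₀ hr0).2 hr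
  have hppos : 0 < p.radius := lt_of_lt_of_le (by simpa using hr0) hpr
  have hP := p.hasFPowerSeriesOnBall hppos
  have hQ := q.hasFPowerSeriesOnBall (lt_of_lt_of_le (by simp) hqr)
  have hPd : DifferentiableOn ℂ p.sum (Metric.ball 0 r⁻¹) := by
    refine hP.differentiableOn.mono ?_
    rw [← Metric.eball_ofReal]
    exact Metric.eball_subset_eball hpr
  have hopen : IsOpen (Metric.ball (0 : ℂ) r⁻¹ ∩ p.sum ⁻¹' {0}ᶜ) :=
    hPd.continuousOn.isOpen_inter_preimage Metric.isOpen_ball isOpen_compl_singleton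
  have hsub : Metric.closedBall (0 : ℂ) 1 ⊆ Metric.ball (0 : ℂ) r⁻¹ ∩ p.sum ⁻¹' {0}ᶜ := by
    intro z hz
    have hz' : ‖z‖ ≤ 1 := by simpa using hz
    refine ⟨by simpa using hz'.trans_lt hr1, ?_⟩
    simpa [hp, ofScalars_sum_apply] using hne z hz'
  -- Compactness of the closed unit disc gives a disc of radius `1 + δ` on which the sum is still
  -- holomorphic and zero-free.
  obtain ⟨δ, hδ, hδs⟩ := (isCompact_closedBall (0 : ℂ) 1).exists_cthickening_subset_open hopen hsub
  rw [cthickening_closedBall hδ.le zero_le_one] at hδs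
  let R : NNReal := ⟨δ + 1, by positivity⟩
  have hg : DifferentiableOn ℂ (fun z => (p.sum z)⁻¹) (Metric.closedBall 0 R) :=
    (hPd.mono fun z hz => (hδs hz).1).inv fun z hz => (hδs hz).2
  have hG := hg.hasFPowerSeriesOnBall (R := R) (by change (0 : ℝ) < δ + 1; positivity)
  have hPQ : ∀ z : ℂ, ‖z‖ < 1 → p.sum z * q.sum z = 1 := by
    intro z hz
    have h1 : Summable fun n => ‖(t n : ℂ) * z ^ n‖ := summable_mul_pow_of_le hr hr0.le ht hz.le
    have h2 : Summable fun n => ‖(d n : ℂ) * z ^ n‖ := by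
      refine Summable.of_nonneg_of_le (fun n => norm_nonneg _) (fun n => ?_)
        ((summable_geometric_of_lt_one (norm_nonneg z) hz).mul_left D)
      rw [norm_mul, norm_pow, Complex.norm_real]
      exact mul_le_mul_of_nonneg_right (hd n) (by positivity)
    rw [hp, hq, ofScalars_sum_apply, ofScalars_sum_apply,
      tsum_mul_tsum_eq_tsum_sum_antidiagonal_of_summable_norm h1 h2]
    have h3 : ∀ n, ∑ a ∈ Finset.HasAntidiagonal.antidiagonal n, (t a.1 : ℂ) * z ^ a.1 * ((d a.2 : ℂ) * z ^ a.2) =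
        if n = 0 then 1 else 0 := by
      intro n
      have h4 := congrArg (PowerSeries.coeff n) htd
      rw [PowerSeries.coeff_mul, PowerSeries.coeff_one] at h4
      simp only [PowerSeries.coeff_mk] at h4
      calc _ = ((∑ a ∈ Finset.HasAntidiagonal.antidiagonal n, t a.1 * d a.2 : ℝ) : ℂ) * z ^ n := by
            rw [Complex.ofReal_sum, Finset.sum_mul]
            refine Finset.sum_congr rfl fun a ha => ?_
            rw [← Finset.HasAntidiagonal.mem_antidiagonal.1 ha]
            push_cast
            ring
        _ = _ := by
            rw [h4]
            split_ifs with h <;> simp [h]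
    simp_rw [h3]
    simp
  have hQg : HasFPowerSeriesAt (fun z => (p.sum z)⁻¹) q 0 := by
    refine hQ.hasFPowerSeriesAt.congr ?_
    filter_upwards [Metric.ball_mem_nhds (0 : ℂ) one_pos] with z hz
    exact eq_inv_of_mul_eq_one_right (hPQ z (by simpa using hz))
  -- By uniqueness of Taylor coefficients, `q` is the Cauchy series of the inverse on the larger
  -- disc, so its radius of convergence is at least `1 + δ`.
  have heq := hQg.eq_formalMultilinearSeries hG.hasFPowerSeriesAt
  have hqR : (R : ENNReal) ≤ q.radius := heq ▸ hG.r_le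
  let s : NNReal := ⟨δ / 2 + 1, by positivity⟩
  have hsR : (s : ENNReal) < q.radius := lt_of_lt_of_le (by
    rw [ENNReal.coe_lt_coe]
    change δ / 2 + 1 < δ + 1
    linarith) hqR
  obtain ⟨B, -, hB⟩ := q.norm_mul_pow_le_of_lt_radius hsR
  have hs1 : (1 : ℝ) < s := by change 1 < δ / 2 + 1; linarith
  refine ⟨(s : ℝ)⁻¹, ⟨by positivity, inv_lt_one_of_one_lt₀ hs1⟩, B, fun n => ?_⟩
  have := hB n
  rw [hq, FormalMultilinearSeries.ofScalars_norm, Complex.norm_real, Real.norm_eq_abs] at this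
  rwa [inv_pow, ← div_eq_mul_inv, le_div_iff₀ (by positivity)]

/-- Kendall's theorem: for an aperiodic law with exponentially decaying tail, the renewal sequence
converges exponentially fast. -/
theorem exists_renewalSeq_sub_le {f : ℕ → ℝ} (h0 : f 0 = 0) (hf : ∀ n, 0 ≤ f n) (h1 : HasSum f 1)
    (hap : ∀ N : ℕ, 2 ≤ N → ∃ n, f n ≠ 0 ∧ ¬ N ∣ n) {C r : ℝ}
    (hr0 : 0 < r) (hr : r < 1) (hfr : ∀ n, f n ≤ C * r ^ n) :
    ∃ ρ ∈ Set.Ioo (0 : ℝ) 1, ∃ B c, ∀ n, |renewalSeq f n - c| ≤ B * ρ ^ n := by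
  have htb := tailSeq_bound h1 hf hr0.le hr hfr
  have hu := renewalSeq_mem_Icc h0 hf h1
  -- The increments of the renewal sequence are the coefficients of the inverse of the tail series.
  -- Their exponential decay makes the renewal sequence Cauchy with a geometric rate.
  let d : ℕ → ℝ := fun n => PowerSeries.coeff n ((1 - PowerSeries.X) *
    PowerSeries.mk (renewalSeq f))
  have hd0 : d 0 = 1 := by simp [d, renewalSeq_zero f h0]
  have hds : ∀ n, d (n + 1) = renewalSeq f (n + 1) - renewalSeq f n := fun n => by
    simp [d, sub_mul, PowerSeries.coeff_succ_X_mul]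
  have htd : PowerSeries.mk (tailSeq f) * PowerSeries.mk d = 1 := by
    have : PowerSeries.mk d = (1 - PowerSeries.X) * PowerSeries.mk (renewalSeq f) := by
      ext n; simp [d]
    rw [this, ← mul_assoc, mul_comm _ (1 - PowerSeries.X), tailSeq_series, renewalSeq_series f h0]
  have hd : ∀ n, ‖d n‖ ≤ 1 := by
    rintro (_ | n)
    · simp [hd0]
    · rw [hds, Real.norm_eq_abs, abs_le]
      constructor <;> linarith [(hu n).1, (hu n).2, (hu (n + 1)).1, (hu (n + 1)).2]
  obtain ⟨ρ, hρ, B, hB⟩ := exists_exponential_decay_of_mul_eq_one htd hr0 hr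
    (fun n => by rw [Real.norm_of_nonneg (htb n).1]; exact (htb n).2) hd
    fun z hz => tsum_tailSeq_ne_zero h0 hf h1 hap hr0.le hr hfr hz
  have hdist : ∀ n, dist (renewalSeq f n) (renewalSeq f (n + 1)) ≤ (B * ρ) * ρ ^ n := fun n => by
    rw [dist_comm, Real.dist_eq, ← hds, mul_assoc, ← pow_succ']
    exact hB _
  obtain ⟨c, hc⟩ := cauchySeq_tendsto_of_complete (cauchySeq_of_le_geometric _ _ hρ.2 hdist)
  refine ⟨ρ, hρ, B * ρ / (1 - ρ), c, fun n => ?_⟩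
  have := dist_le_of_le_geometric_of_tendsto _ _ hρ.2 hdist hc n
  rw [Real.dist_eq] at this
  exact this.trans (le_of_eq (by ring))

/-! ### Correlation kernels of regenerative processes -/

/-- Subtract the penultimate column from the last. The terms `h` cancel, and since the points
increase, only the bottom entry survives, equal to `g` of the last two points. -/
theorem Matrix.det_sub_strict_of_strictMono {ι R : Type*} [LinearOrder ι] [CommRing R]
    (h : ι → R) (g : ι → ι → R) {n : ℕ} {x : Fin (n + 2) → ι} (hx : StrictMono x) :
    (Matrix.of fun i j => h (x i) - if x j < x i then g (x j) (x i) else 0).det =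
      (Matrix.of fun i j : Fin (n + 1) => h (x i.castSucc) -
        if x j.castSucc < x i.castSucc then g (x j.castSucc) (x i.castSucc) else 0).det *
      g (x (Fin.last n).castSucc) (x (Fin.last (n + 1))) := by
  set A : Matrix (Fin (n + 2)) (Fin (n + 2)) R :=
    Matrix.of fun i j => h (x i) - if x j < x i then g (x j) (x i) else 0 with hA
  have hne : Fin.last (n + 1) ≠ (Fin.last n).castSucc := (Fin.castSucc_lt_last _).ne'
  rw [← Matrix.det_updateCol_add_smul_self A hne (-1),
    Matrix.det_succ_column _ (Fin.last (n + 1)), Fin.sum_univ_castSucc, Finset.sum_eq_zero,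
    zero_add]
  · have hsub : (A.updateCol (Fin.last (n + 1)) fun k => A k (Fin.last (n + 1)) + (-1 : R) •
        A k (Fin.last n).castSucc).submatrix (Fin.last (n + 1)).succAbove
          (Fin.last (n + 1)).succAbove = Matrix.of fun i j : Fin (n + 1) => h (x i.castSucc) -
        if x j.castSucc < x i.castSucc then g (x j.castSucc) (x i.castSucc) else 0 := by
      ext i j
      simp [hA, (Fin.castSucc_lt_last j).ne]
    rw [hsub]
    have hlt : x (Fin.last n).castSucc < x (Fin.last (n + 1)) := hx (Fin.castSucc_lt_last _)
    simp [hA, hlt, ← two_mul, mul_comm]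
  · intro i _
    have h1 : ¬ x (Fin.last (n + 1)) < x i.castSucc := (hx (Fin.castSucc_lt_last i)).not_gt
    have h2 : ¬ x (Fin.last n).castSucc < x i.castSucc :=
      (hx.monotone (Fin.castSucc_le_castSucc_iff.2 (Fin.le_last i))).not_gt
    simp [hA, h1, h2]

/-- A point process on a linear order such that, conditionally on containing `Y`, the point `y`
above `x = max Y` belongs to the process with probability `g x y`, is determinantal. -/
theorem IsCorrelationKernel.of_regenerative {ι : Type*} [LinearOrder ι] (P : Measure (Set ι))
    [IsProbabilityMeasure P] (h : ι → ℝ) (g : ι → ι → ℝ)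
    (hh : ∀ x, P.real {A | x ∈ A} = h x)
    (hg : ∀ (Y : Finset ι) (x y : ι), x ∈ Y → (∀ z ∈ Y, z ≤ x) → x < y →
      P.real {A | ((insert y Y : Finset ι) : Set ι) ⊆ A} =
        P.real {A | (Y : Set ι) ⊆ A} * g x y) :
    IsCorrelationKernel P
      (Matrix.of fun x y => h x - if y < x then g y x else 0 : Matrix ι ι ℝ) := by
  have key : ∀ (n : ℕ) (x : Fin n → ι), StrictMono x → P.real {A | ∀ i, x i ∈ A} =
      (Matrix.of fun i j => h (x i) - if x j < x i then g (x j) (x i) else 0).det := by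
    intro n
    induction n with
    | zero => intro x _; simp
    | succ n ih =>
      intro x hx
      cases n with
      | zero => simp [← hh, Fin.forall_fin_one]
      | succ n =>
        rw [Matrix.det_sub_strict_of_strictMono h g hx,
          ← ih (fun i => x i.castSucc) (hx.comp Fin.strictMono_castSucc)]
        have := hg (Finset.univ.image fun i : Fin (n + 1) => x i.castSucc)
          (x (Fin.last n).castSucc) (x (Fin.last (n + 1))) (by simp) ?_
          (hx (Fin.castSucc_lt_last _))
        · have e1 : ∀ A : Set ι, ((Finset.univ.image fun i : Fin (n + 1) => x i.castSucc :
              Finset ι) : Set ι) ⊆ A ↔ ∀ i : Fin (n + 1), x i.castSucc ∈ A := fun A => by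
            simp [Set.range_subset_iff]
          simp only [Finset.coe_insert, Set.insert_subset_iff, e1] at this
          rw [← this]
          simp only [Fin.forall_fin_succ', and_comm]
        · simp only [Finset.mem_image, Finset.mem_univ, true_and]
          rintro _ ⟨i, rfl⟩
          exact hx.monotone (Fin.castSucc_le_castSucc_iff.2 (Fin.le_last i))
  refine ⟨inferInstance, fun Y => ?_⟩
  let e := Y.orderIsoOfFin rfl
  have := key Y.card (fun i => e i) fun i j hij => e.strictMono hij
  rw [← Matrix.det_submatrix_equiv_self e.toEquiv]
  refine Eq.trans ?_ this
  have hset : {A : Set ι | (Y : Set ι) ⊆ A} = {A | ∀ i, (e i : ι) ∈ A} := by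
    ext A
    refine ⟨fun hA i => hA (e i).2, fun hA y hy => ?_⟩
    simpa using hA (e.symm ⟨y, hy⟩)
  rw [hset]
  rfl

/-- Diagonal conjugation preserves principal minors; this freedom is what makes a bounded kernel
available. -/
theorem IsCorrelationKernel.conj {X : Type*} [DecidableEq X] {𝕜 : Type*} [RCLike 𝕜]
    {P : Measure (Set X)} {K : Matrix X X 𝕜} (hK : IsCorrelationKernel P K) {a : X → 𝕜}
    (ha : ∀ x, a x ≠ 0) :
    IsCorrelationKernel P (Matrix.of fun x y => a x * K x y * (a y)⁻¹) := by
  refine ⟨hK.isProbabilityMeasure, fun Y => ?_⟩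
  have : (Matrix.of fun x y => a x * K x y * (a y)⁻¹).submatrix (fun y : Y => (y : X))
        (fun y : Y => (y : X)) =
      Matrix.diagonal (fun y : Y => a y) * K.submatrix (fun y : Y => (y : X))
        (fun y : Y => (y : X)) * Matrix.diagonal (fun y : Y => (a y)⁻¹) := by
    ext i j
    simp [Matrix.mul_diagonal, Matrix.diagonal_mul]
  rw [hK.correlation_eq_det, this, Matrix.det_mul, Matrix.det_mul, Matrix.det_diagonal,
    Matrix.det_diagonal, mul_right_comm, ← Finset.prod_mul_distrib]
  simp [ha]

theorem IsCorrelationKernel.map_ofReal {X : Type*} [DecidableEq X] (𝕜 : Type*) [RCLike 𝕜]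
    {P : Measure (Set X)} {K : Matrix X X ℝ} (hK : IsCorrelationKernel P K) :
    IsCorrelationKernel P (Matrix.of fun x y => (K x y : 𝕜)) := by
  refine ⟨hK.isProbabilityMeasure, fun Y => ?_⟩
  have h := hK.correlation_eq_det Y
  rw [RCLike.ofReal_real_eq_id, id] at h
  rw [h]
  exact RingHom.map_det (algebraMap ℝ 𝕜) _

/-! ### Correlations of the delayed renewal process -/

/-- The renewal series is the geometric series in `F = mk f`. As `f 0 = 0`, the powers beyond `d` do
not reach the coefficient of degree `d`. -/
theorem renewalSeq_eq_sum_coeff_pow {f : ℕ → ℝ} (h0 : f 0 = 0) (d : ℕ) :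
    renewalSeq f d = ∑ i ∈ Finset.range (d + 1), PowerSeries.coeff d (PowerSeries.mk f ^ i) := by
  have h1 : ∑ i ∈ Finset.range (d + 1), PowerSeries.mk f ^ i =
      PowerSeries.mk (renewalSeq f) -
        PowerSeries.mk (renewalSeq f) * PowerSeries.mk f ^ (d + 1) := by
    have h2 := mul_neg_geom_sum (PowerSeries.mk f) (d + 1)
    have h3 := renewalSeq_series f h0
    linear_combination (PowerSeries.mk (renewalSeq f)) * h2 -
      (∑ i ∈ Finset.range (d + 1), PowerSeries.mk f ^ i) * h3
  have hX : PowerSeries.X ^ (d + 1) ∣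
      PowerSeries.mk (renewalSeq f) * PowerSeries.mk f ^ (d + 1) :=
    Dvd.dvd.mul_left (pow_dvd_pow_of_dvd (PowerSeries.X_dvd_iff.2 (by simp [h0])) _) _
  rw [← map_sum, h1, map_sub, PowerSeries.X_pow_dvd_iff.1 hX d (Nat.lt_succ_self d)]
  simp

theorem renewalSum_strictMono {Ω : Type*} (ξ : ℕ → Ω → ℕ+) (ω : Ω) :
    StrictMono fun n => (renewalSum ξ n ω : ℕ) :=
  strictMono_nat_of_lt_succ fun n => by
    change (renewalSum ξ n ω : ℕ) < ((renewalSum ξ n ω + ξ (n + 1) ω : ℕ+) : ℕ)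
    rw [PNat.add_coe]
    exact Nat.lt_add_of_pos_right (PNat.pos _)

theorem measureReal_biUnion_inter {Ω ι : Type*} [MeasurableSpace Ω] (μ : Measure Ω)
    [IsFiniteMeasure μ] (s : Finset ι) (E : ι → Set Ω) (hE : ∀ i ∈ s, MeasurableSet (E i))
    (hd : ∀ i ∈ s, ∀ j ∈ s, i ≠ j → Disjoint (E i) (E j)) {B : Set Ω}
    (hB : ∀ ω, ω ∈ B ↔ ∃ i ∈ s, ω ∈ E i) :
    μ.real B = ∑ i ∈ s, μ.real (E i) := by
  have : B = ⋃ i ∈ s, E i := by ext ω; simp [hB]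
  rw [this]
  exact measureReal_biUnion_finset (fun i hi j hj hij => hd i hi j hj hij) hE

section

variable {Ω : Type*} [MeasurableSpace Ω] {μ : Measure Ω} {ξ : ℕ → Ω → ℕ+}

theorem IsDelayedRenewalSequence.stronglyMeasurable (hξ : IsDelayedRenewalSequence μ ξ) (n : ℕ) :
    StronglyMeasurable fun ω => (ξ n ω : ℕ) :=
  (Measurable.of_discrete.comp (hξ.measurable n) :
    Measurable ((fun m : ℕ+ => (m : ℕ)) ∘ ξ n)).stronglyMeasurable

/-- The history of the renewal process. -/
noncomputable def IsDelayedRenewalSequence.history (hξ : IsDelayedRenewalSequence μ ξ) :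
    Filtration ℕ ‹MeasurableSpace Ω› :=
  Filtration.natural (fun n ω => (ξ n ω : ℕ)) hξ.stronglyMeasurable

theorem IsDelayedRenewalSequence.measurable_history (hξ : IsDelayedRenewalSequence μ ξ) {k n : ℕ}
    (hkn : k ≤ n) : Measurable[hξ.history n] fun ω => (ξ k ω : ℕ) :=
  ((Filtration.stronglyAdapted_natural hξ.stronglyMeasurable k).measurable).mono
    (hξ.history.mono hkn) le_rfl

theorem IsDelayedRenewalSequence.measurable_renewalSum_history
    (hξ : IsDelayedRenewalSequence μ ξ) {k n : ℕ} (hkn : k ≤ n) :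
    Measurable[hξ.history n] fun ω => (renewalSum ξ k ω : ℕ) := by
  induction k with
  | zero => exact hξ.measurable_history hkn
  | succ k ih =>
    have : (fun ω => (renewalSum ξ (k + 1) ω : ℕ)) =
        fun ω => (renewalSum ξ k ω : ℕ) + (ξ (k + 1) ω : ℕ) := by
      funext ω; exact PNat.add_coe _ _
    rw [this]
    exact (ih (by omega)).add (hξ.measurable_history hkn)

theorem IsDelayedRenewalSequence.measurableSet_renewalSum_eq
    (hξ : IsDelayedRenewalSequence μ ξ) {k n : ℕ} (hkn : k ≤ n) (x : ℕ) :
    MeasurableSet[hξ.history n] {ω | (renewalSum ξ k ω : ℕ) = x} :=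
  hξ.measurable_renewalSum_history hkn (measurableSet_singleton x)

theorem IsDelayedRenewalSequence.measureReal_inter_step (hξ : IsDelayedRenewalSequence μ ξ)
    {k : ℕ} {E : Set Ω} (hE : MeasurableSet[hξ.history k] E) (b : ℕ) :
    μ.real (E ∩ {ω | (ξ (k + 1) ω : ℕ) = b}) = μ.real E * μ.real {ω | (ξ 1 ω : ℕ) = b} := by
  have hi : iIndepFun (fun n ω => (ξ n ω : ℕ)) μ :=
    hξ.indep.comp (fun _ m => (m : ℕ)) fun _ => Measurable.of_discrete
  have h1 : Indep (⨆ n ∈ ({k + 1} : Set ℕ), MeasurableSpace.comap (fun ω => (ξ n ω : ℕ)) ⊤)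
      (hξ.history k) μ :=
    indep_iSup_of_disjoint (T := {n | n ≤ k})
      (fun n => (hξ.stronglyMeasurable n).measurable.comap_le) hi (by simp)
  rw [iSup_singleton] at h1
  have h2 := (Indep_iff _ _ μ).1 h1 {ω | (ξ (k + 1) ω : ℕ) = b} E
    ⟨{b}, measurableSet_singleton b, rfl⟩ hE
  have h3 : μ {ω | (ξ (k + 1) ω : ℕ) = b} = μ {ω | (ξ 1 ω : ℕ) = b} :=
    (hξ.identDistrib (k + 1) (by omega)).measure_mem_eq
      (s := {m : ℕ+ | (m : ℕ) = b}) MeasurableSet.of_discrete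
  rw [measureReal_def, Set.inter_comm, h2, h3, ENNReal.toReal_mul, mul_comm]
  rfl

theorem IsDelayedRenewalSequence.measurable_range (hξ : IsDelayedRenewalSequence μ ξ) :
    Measurable fun ω => Set.range fun n => renewalSum ξ n ω := by
  rw [measurable_set_iff]
  intro a
  refine measurableSet_setOfPred.1 ?_
  have : {ω | a ∈ Set.range fun n => renewalSum ξ n ω} =
      ⋃ j, {ω | (renewalSum ξ j ω : ℕ) = (a : ℕ)} := by
    ext; simp
  rw [this]
  exact MeasurableSet.iUnion fun j => hξ.history.le _ _
    (hξ.measurableSet_renewalSum_eq le_rfl _)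

theorem IsDelayedRenewalSequence.renewalProcess_real_subset (hξ : IsDelayedRenewalSequence μ ξ)
    (Y : Finset ℕ+) :
    (renewalProcess μ ξ).real {A | (Y : Set ℕ+) ⊆ A} =
      μ.real {ω | ∀ z ∈ Y, ∃ j, renewalSum ξ j ω = z} := by
  rw [renewalProcess, map_measureReal_apply hξ.measurable_range (measurableSet_finset_subset Y)]
  rfl

variable [IsProbabilityMeasure μ]

/-- The sum of `j` fresh steps is independent of the history and distributed as a `j`-fold
convolution; the induction splits according to the value of the last step. -/
theorem IsDelayedRenewalSequence.measureReal_inter_renewalSum_add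
    (hξ : IsDelayedRenewalSequence μ ξ) {k : ℕ} {E : Set Ω}
    (hE : MeasurableSet[hξ.history k] E) {x : ℕ} (hEx : ∀ ω ∈ E, (renewalSum ξ k ω : ℕ) = x)
    (j d : ℕ) :
    μ.real (E ∩ {ω | (renewalSum ξ (k + j) ω : ℕ) = x + d}) = μ.real E *
      PowerSeries.coeff d (PowerSeries.mk (fun n => μ.real {ω | (ξ 1 ω : ℕ) = n}) ^ j) := by
  induction j generalizing d with
  | zero =>
    rw [pow_zero, PowerSeries.coeff_one]
    split_ifs with hd
    · have : E ∩ {ω | (renewalSum ξ (k + 0) ω : ℕ) = x + d} = E :=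
        Set.inter_eq_left.2 fun ω hω => by simpa [hd] using hEx ω hω
      rw [this, mul_one]
    · have : E ∩ {ω | (renewalSum ξ (k + 0) ω : ℕ) = x + d} = ∅ := by
        ext ω
        simp only [Set.mem_inter_iff, Set.mem_ofPred_eq, Set.mem_empty_iff_false, iff_false,
          not_and, add_zero]
        intro hω
        have := hEx ω hω
        omega
      rw [this, measureReal_empty, mul_zero]
  | succ j ih =>
    have hm : ∀ a, MeasurableSet[hξ.history (k + j)]
        (E ∩ {ω | (renewalSum ξ (k + j) ω : ℕ) = x + a}) := fun a =>
      MeasurableSet.inter (hξ.history.mono (Nat.le_add_right k j) _ hE)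
        (hξ.measurableSet_renewalSum_eq le_rfl _)
    rw [measureReal_biUnion_inter μ (Finset.HasAntidiagonal.antidiagonal d)
      (fun a => (E ∩ {ω | (renewalSum ξ (k + j) ω : ℕ) = x + a.1}) ∩
        {ω | (ξ (k + j + 1) ω : ℕ) = a.2})]
    · rw [pow_succ, PowerSeries.coeff_mul, Finset.mul_sum]
      refine Finset.sum_congr rfl fun a _ => ?_
      rw [hξ.measureReal_inter_step (hm a.1), ih, PowerSeries.coeff_mk, mul_assoc]
    · intro a _
      exact (hξ.history.le _ _ (hm a.1)).inter
        ((hξ.stronglyMeasurable _).measurable (measurableSet_singleton a.2))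
    · intro a _ b _ hab
      refine Set.disjoint_left.2 fun ω ha hb => hab ?_
      simp only [Set.mem_inter_iff, Set.mem_ofPred_eq] at ha hb
      exact Prod.ext (by omega) (by omega)
    · intro ω
      simp only [Set.mem_inter_iff, Set.mem_ofPred_eq, Finset.HasAntidiagonal.mem_antidiagonal]
      have hs : (renewalSum ξ (k + (j + 1)) ω : ℕ) =
        (renewalSum ξ (k + j) ω : ℕ) + (ξ (k + j + 1) ω : ℕ) := PNat.add_coe _ _
      constructor
      · rintro ⟨hω, h⟩
        have h1 := (renewalSum_strictMono ξ ω).monotone (Nat.le_add_right k j)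
        have h2 := hEx ω hω
        exact ⟨((renewalSum ξ (k + j) ω : ℕ) - x, (ξ (k + j + 1) ω : ℕ)),
          by simp only; omega, ⟨hω, by simp only; omega⟩, rfl⟩
      · rintro ⟨a, ha, ⟨hω, h1⟩, h2⟩
        exact ⟨hω, by omega⟩

/-- The renewal property: after visiting `x`, the process visits `x + d` with the probability
given by the renewal sequence. -/
theorem IsDelayedRenewalSequence.measureReal_inter_exists (hξ : IsDelayedRenewalSequence μ ξ)
    {k : ℕ} {E : Set Ω} (hE : MeasurableSet[hξ.history k] E) {x : ℕ}
    (hEx : ∀ ω ∈ E, (renewalSum ξ k ω : ℕ) = x) (d : ℕ) :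
    μ.real (E ∩ {ω | ∃ j, (renewalSum ξ j ω : ℕ) = x + d}) =
      μ.real E * renewalSeq (fun n => μ.real {ω | (ξ 1 ω : ℕ) = n}) d := by
  -- Split by the number `j` of further steps. The sums increase strictly, so the events are
  -- disjoint and `j ≤ d`.
  rw [renewalSeq_eq_sum_coeff_pow (by simp), Finset.mul_sum, measureReal_biUnion_inter μ
    (Finset.range (d + 1)) fun j => E ∩ {ω | (renewalSum ξ (k + j) ω : ℕ) = x + d}]
  · exact Finset.sum_congr rfl fun j _ => hξ.measureReal_inter_renewalSum_add hE hEx j d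
  · intro j _
    exact (hξ.history.le _ _ hE).inter
      (hξ.history.le _ _ (hξ.measurableSet_renewalSum_eq le_rfl _))
  · intro i _ j _ hij
    refine Set.disjoint_left.2 fun ω ha hb => hij ?_
    have := (renewalSum_strictMono ξ ω).injective (ha.2.trans hb.2.symm)
    omega
  · intro ω
    constructor
    · rintro ⟨hω, j, hj⟩
      have hx := hEx ω hω
      have hkj : k ≤ j := (renewalSum_strictMono ξ ω).le_iff_le.1 (by omega)
      obtain ⟨i, rfl⟩ := Nat.exists_eq_add_of_le hkj
      refine ⟨i, ?_, hω, hj⟩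
      have := (renewalSum_strictMono ξ ω).add_le_nat i k
      simp only [add_comm i k] at this
      rw [Finset.mem_range]
      omega
    · rintro ⟨j, _, hω, hj⟩
      exact ⟨hω, k + j, hj⟩

/-- Condition on the value of `ξ 0` and apply the renewal property at time `0`. -/
theorem IsDelayedRenewalSequence.measureReal_exists_eq (hξ : IsDelayedRenewalSequence μ ξ)
    (x : ℕ) :
    μ.real {ω | ∃ j, (renewalSum ξ j ω : ℕ) = x} =
      ∑ a ∈ Finset.HasAntidiagonal.antidiagonal x, μ.real {ω | (ξ 0 ω : ℕ) = a.1} *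
        renewalSeq (fun n => μ.real {ω | (ξ 1 ω : ℕ) = n}) a.2 := by
  have hm : ∀ a, MeasurableSet[hξ.history 0] {ω | (ξ 0 ω : ℕ) = a} := fun a =>
    hξ.measurable_history le_rfl (measurableSet_singleton a)
  have hex : MeasurableSet {ω | ∃ j, (renewalSum ξ j ω : ℕ) = x} := by
    have : {ω | ∃ j, (renewalSum ξ j ω : ℕ) = x} = ⋃ j, {ω | (renewalSum ξ j ω : ℕ) = x} := by
      ext; simp
    rw [this]
    exact MeasurableSet.iUnion fun j => hξ.history.le _ _
      (hξ.measurableSet_renewalSum_eq le_rfl _)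
  rw [measureReal_biUnion_inter μ (Finset.HasAntidiagonal.antidiagonal x) fun a =>
    {ω | (ξ 0 ω : ℕ) = a.1} ∩ {ω | ∃ j, (renewalSum ξ j ω : ℕ) = x}]
  · refine Finset.sum_congr rfl fun a ha => ?_
    rw [← Finset.HasAntidiagonal.mem_antidiagonal.1 ha]
    exact hξ.measureReal_inter_exists (hm a.1) (fun ω hω => hω) a.2
  · exact fun a _ => (hξ.history.le _ _ (hm a.1)).inter hex
  · intro a ha b hb hab
    refine Set.disjoint_left.2 fun ω h1 h2 => hab ?_
    rw [Finset.HasAntidiagonal.mem_antidiagonal] at ha hb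
    simp only [Set.mem_inter_iff, Set.mem_ofPred_eq] at h1 h2
    exact Prod.ext (by omega) (by omega)
  · intro ω
    constructor
    · rintro ⟨j, hj⟩
      have := (renewalSum_strictMono ξ ω).monotone (Nat.zero_le j)
      have h0 : (renewalSum ξ 0 ω : ℕ) = ξ 0 ω := rfl
      refine ⟨((ξ 0 ω : ℕ), x - ξ 0 ω), ?_, rfl, j, hj⟩
      rw [Finset.HasAntidiagonal.mem_antidiagonal]
      simp only
      omega
    · rintro ⟨a, _, _, h⟩
      exact h

/-- Split by the index `k` with `renewalSum ξ k = x`. Since `x` is the maximum of `Y`, all of `Y`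
has been visited by then, so the event `E k` lies in the history up to `k` and the renewal property
applies. -/
theorem IsDelayedRenewalSequence.measureReal_forall_insert (hξ : IsDelayedRenewalSequence μ ξ)
    (Y : Finset ℕ+) {x y : ℕ+} (hxY : x ∈ Y) (hY : ∀ z ∈ Y, z ≤ x) (hxy : x < y) :
    μ.real {ω | ∀ z ∈ insert y Y, ∃ j, renewalSum ξ j ω = z} =
      μ.real {ω | ∀ z ∈ Y, ∃ j, renewalSum ξ j ω = z} *
        renewalSeq (fun n => μ.real {ω | (ξ 1 ω : ℕ) = n}) ((y : ℕ) - x) := by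
  let E : ℕ → Set Ω := fun k => {ω | (renewalSum ξ k ω : ℕ) = x} ∩
    {ω | ∀ z ∈ Y, ∃ j ≤ k, (renewalSum ξ j ω : ℕ) = z}
  have hE : ∀ k, MeasurableSet[hξ.history k] (E k) := by
    intro k
    refine MeasurableSet.inter (hξ.measurableSet_renewalSum_eq le_rfl _) ?_
    have : {ω | ∀ z ∈ Y, ∃ j ≤ k, (renewalSum ξ j ω : ℕ) = z} =
        ⋂ z ∈ Y, ⋃ j ∈ Finset.range (k + 1), {ω | (renewalSum ξ j ω : ℕ) = (z : ℕ)} := by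
      ext ω; simp
    rw [this]
    exact Finset.measurableSet_biInter _ fun z _ => Finset.measurableSet_biUnion _ fun j hj =>
      hξ.measurableSet_renewalSum_eq (Nat.lt_succ_iff.1 (Finset.mem_range.1 hj)) _
  have hdisj : ∀ i j, i ≠ j → Disjoint (E i) (E j) := fun i j hij =>
    Set.disjoint_left.2 fun ω ha hb =>
      hij ((renewalSum_strictMono ξ ω).injective (ha.1.trans hb.1.symm))
  have hmem : ∀ ω, (∀ z ∈ Y, ∃ j, renewalSum ξ j ω = z) ↔
      ∃ k ∈ Finset.range (x + 1), ω ∈ E k := by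
    intro ω
    constructor
    · intro h
      obtain ⟨k, hk⟩ := h x hxY
      refine ⟨k, ?_, by simp [hk], fun z hz => ?_⟩
      · have := (renewalSum_strictMono ξ ω).le_apply (x := k)
        simp only [hk] at this
        exact Finset.mem_range.2 (by omega)
      · obtain ⟨j, hj⟩ := h z hz
        refine ⟨j, (renewalSum_strictMono ξ ω).le_iff_le.1 ?_, by rw [hj]⟩
        simpa [hj, hk] using hY z hz
    · rintro ⟨k, _, hk⟩ z hz
      obtain ⟨j, _, hj⟩ := hk.2 z hz
      exact ⟨j, PNat.coe_injective hj⟩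
  have hex : MeasurableSet {ω | ∃ j, (renewalSum ξ j ω : ℕ) = y} := by
    have : {ω | ∃ j, (renewalSum ξ j ω : ℕ) = y} = ⋃ j, {ω | (renewalSum ξ j ω : ℕ) = (y : ℕ)} := by
      ext; simp
    rw [this]
    exact MeasurableSet.iUnion fun j => hξ.history.le _ _
      (hξ.measurableSet_renewalSum_eq le_rfl _)
  rw [measureReal_biUnion_inter μ (Finset.range (x + 1)) E
      (fun k _ => hξ.history.le _ _ (hE k)) (fun i _ j _ => hdisj i j)
      (B := {ω | ∀ z ∈ Y, ∃ j, renewalSum ξ j ω = z}) hmem,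
    measureReal_biUnion_inter μ (Finset.range (x + 1))
      (fun k => E k ∩ {ω | ∃ j, (renewalSum ξ j ω : ℕ) = y})
      (fun k _ => (hξ.history.le _ _ (hE k)).inter hex)
      (fun i _ j _ hij => (hdisj i j hij).mono Set.inter_subset_left Set.inter_subset_left) ?_,
    Finset.sum_mul]
  · refine Finset.sum_congr rfl fun k _ => ?_
    rw [← hξ.measureReal_inter_exists (hE k) (fun ω hω => hω.1),
      Nat.add_sub_cancel' (PNat.coe_le_coe _ _ |>.2 hxy.le)]
  · intro ω
    rw [Set.mem_ofPred_eq, Finset.forall_mem_insert, hmem]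
    simp only [Set.mem_inter_iff, Set.mem_ofPred_eq, PNat.coe_inj]
    constructor
    · rintro ⟨h1, k, hk, h2⟩
      exact ⟨k, hk, h2, h1⟩
    · rintro ⟨k, hk, h2, h1⟩
      exact ⟨h1, k, hk, h2⟩

theorem IsDelayedRenewalSequence.isCorrelationKernel (hξ : IsDelayedRenewalSequence μ ξ) :
    IsCorrelationKernel (renewalProcess μ ξ) (Matrix.of fun x y : ℕ+ =>
      μ.real {ω | ∃ j, (renewalSum ξ j ω : ℕ) = x} -
        if y < x then renewalSeq (fun n => μ.real {ω | (ξ 1 ω : ℕ) = n}) ((x : ℕ) - y) else 0 :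
      Matrix ℕ+ ℕ+ ℝ) := by
  have : IsProbabilityMeasure (renewalProcess μ ξ) :=
    Measure.isProbabilityMeasure_map hξ.measurable_range.aemeasurable
  refine IsCorrelationKernel.of_regenerative (renewalProcess μ ξ)
    (fun x => μ.real {ω | ∃ j, (renewalSum ξ j ω : ℕ) = x})
    (fun y x => renewalSeq (fun n => μ.real {ω | (ξ 1 ω : ℕ) = n}) ((x : ℕ) - y)) ?_ ?_
  · intro x
    have := hξ.renewalProcess_real_subset {x}
    simpa using this
  · intro Y x y hxY hY hxy
    rw [hξ.renewalProcess_real_subset, hξ.renewalProcess_real_subset]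
    exact hξ.measureReal_forall_insert Y hxY hY hxy

end

/-! ### Boundedness of the correlation kernel -/

/-- Write the error as `∑ g k * (u (n - k) - c)` minus `c` times the tail of `g`. Taking `τ`
strictly above both `r` and `ρ` turns the convolution of the two exponential bounds into a
convergent geometric sum times `τ ^ n`. -/
theorem abs_convolution_sub_le {g u : ℕ → ℝ} (hg : ∀ n, 0 ≤ g n) (hg1 : HasSum g 1)
    {C r : ℝ} (hr0 : 0 < r) (hr : r < 1) (hgr : ∀ n, g n ≤ C * r ^ n) {B c ρ : ℝ}
    (hρ : ρ ∈ Set.Ioo (0 : ℝ) 1) (hu : ∀ n, |u n - c| ≤ B * ρ ^ n) :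
    ∃ τ ∈ Set.Ioo (0 : ℝ) 1, ∃ D, 0 ≤ D ∧ (∀ n, |u n - c| ≤ D * τ ^ n) ∧
      ∀ n, |∑ a ∈ Finset.HasAntidiagonal.antidiagonal n, g a.1 * u a.2 - c| ≤ D * τ ^ n := by
  obtain ⟨τ, hτ, hτ1⟩ := exists_between (max_lt hr hρ.2)
  have hrτ : r < τ := (le_max_left _ _).trans_lt hτ
  have hρτ : ρ < τ := (le_max_right _ _).trans_lt hτ
  have hτ0 : 0 < τ := hr0.trans hrτ
  have hB : 0 ≤ B := by simpa using (abs_nonneg _).trans (hu 0)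
  have hC : 0 ≤ C := by simpa using (hg 0).trans (hgr 0)
  have h1r : 0 < 1 - r := sub_pos.2 hr
  have hq1 : r / τ < 1 := (div_lt_one hτ0).2 hrτ
  have h1q : 0 < 1 - r / τ := sub_pos.2 hq1
  have huτ : ∀ n, |u n - c| ≤ B * τ ^ n := fun n =>
    (hu n).trans (mul_le_mul_of_nonneg_left (pow_le_pow_left₀ hρ.1.le hρτ.le n) hB)
  refine ⟨τ, ⟨hτ0, hτ1⟩, B + (C * B * (1 - r / τ)⁻¹ + |c| * (C / (1 - r))), by positivity,
    fun n => (huτ n).trans (mul_le_mul_of_nonneg_right (le_add_of_nonneg_right (by positivity))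
      (by positivity)), fun n => ?_⟩
  have hsplit : ∑ a ∈ Finset.HasAntidiagonal.antidiagonal n, g a.1 * u a.2 - c =
      ∑ k ∈ Finset.range (n + 1), g k * (u (n - k) - c) - c * tailSeq g n := by
    rw [Finset.Nat.sum_antidiagonal_eq_sum_range_succ_mk, tailSeq]
    simp only [mul_sub, Finset.sum_sub_distrib, ← Finset.sum_mul]
    ring
  have h1 : |∑ k ∈ Finset.range (n + 1), g k * (u (n - k) - c)| ≤
      C * B * (1 - r / τ)⁻¹ * τ ^ n := by
    refine (Finset.abs_sum_le_sum_abs _ _).trans ?_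
    have hle : ∀ k ∈ Finset.range (n + 1), |g k * (u (n - k) - c)| ≤
        C * B * τ ^ n * (r / τ) ^ k := by
      intro k hk
      have hk' : k ≤ n := Nat.lt_succ_iff.1 (Finset.mem_range.1 hk)
      rw [abs_mul, abs_of_nonneg (hg k)]
      refine (mul_le_mul (hgr k) (huτ (n - k)) (abs_nonneg _) (by positivity)).trans (le_of_eq ?_)
      rw [div_pow, pow_sub₀ _ hτ0.ne' hk']
      ring
    refine (Finset.sum_le_sum hle).trans ?_
    rw [← Finset.mul_sum]
    have hgeo : ∑ k ∈ Finset.range (n + 1), (r / τ) ^ k ≤ (1 - r / τ)⁻¹ :=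
      sum_le_hasSum _ (fun k _ => by positivity)
        (hasSum_geometric_of_lt_one (by positivity) hq1)
    calc _ ≤ C * B * τ ^ n * (1 - r / τ)⁻¹ := mul_le_mul_of_nonneg_left hgeo (by positivity)
      _ = _ := by ring
  have h2 : |c * tailSeq g n| ≤ |c| * (C / (1 - r)) * τ ^ n := by
    have ht := tailSeq_bound hg1 hg hr0.le hr hgr n
    rw [abs_mul, abs_of_nonneg ht.1, mul_assoc]
    refine mul_le_mul_of_nonneg_left (ht.2.trans ?_) (abs_nonneg _)
    exact mul_le_mul_of_nonneg_left (pow_le_pow_left₀ hr0.le hrτ.le n) (by positivity)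
  rw [hsplit, add_mul, add_mul]
  have h3 := abs_sub (∑ k ∈ Finset.range (n + 1), g k * (u (n - k) - c)) (c * tailSeq g n)
  have h4 : 0 ≤ B * τ ^ n := by positivity
  linarith

/-- For `x ≤ y` the conjugating factor `κ ^ (y - x)` supplies the decay and `h ≤ 1` suffices. For `y
< x` the factor `κ ^ (-(x - y))` grows, but the difference `h x - u (x - y)` is of order `κ ^ (2 *
(x - y))`. -/
theorem abs_conj_kernel_le {h u : ℕ → ℝ} {D c κ : ℝ} (hκ : κ ∈ Set.Ioo (0 : ℝ) 1) (hD : 0 ≤ D)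
    (hh : ∀ n, |h n - c| ≤ D * (κ ^ 2) ^ n) (hu : ∀ n, |u n - c| ≤ D * (κ ^ 2) ^ n)
    (hh1 : ∀ n, h n ∈ Set.Icc (0 : ℝ) 1) (x y : ℕ) :
    |(κ ^ x)⁻¹ * (h x - if y < x then u (x - y) else 0) * ((κ ^ y)⁻¹)⁻¹| ≤
      (1 + 2 * D) * κ ^ ((x : ℤ) - (y : ℤ)).natAbs := by
  have hκ0 := hκ.1
  rw [abs_mul, abs_mul, inv_inv, abs_of_pos (show 0 < (κ ^ x)⁻¹ by positivity),
    abs_of_pos (show 0 < κ ^ y by positivity)]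
  rcases le_or_gt x y with hxy | hxy
  · obtain ⟨d, rfl⟩ := Nat.exists_eq_add_of_le hxy
    have he : ((x : ℤ) - ((x + d : ℕ) : ℤ)).natAbs = d := by omega
    rw [he, if_neg hxy.not_gt, sub_zero, abs_of_nonneg (hh1 x).1, pow_add]
    calc (κ ^ x)⁻¹ * h x * (κ ^ x * κ ^ d) = h x * κ ^ d := by field_simp
      _ ≤ (1 + 2 * D) * κ ^ d :=
        mul_le_mul_of_nonneg_right (by linarith [(hh1 x).2]) (by positivity)
  · obtain ⟨d, rfl⟩ := Nat.exists_eq_add_of_le hxy.le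
    have he : (((y + d : ℕ) : ℤ) - (y : ℤ)).natAbs = d := by omega
    rw [he, if_pos hxy, Nat.add_sub_cancel_left]
    have h1 : |h (y + d) - u d| ≤ 2 * D * (κ ^ 2) ^ d := by
      have e1 := abs_sub_le (h (y + d)) c (u d)
      have e2 := hu d
      rw [abs_sub_comm] at e2
      have e3 : D * (κ ^ 2) ^ (y + d) ≤ D * (κ ^ 2) ^ d :=
        mul_le_mul_of_nonneg_left (pow_le_pow_of_le_one (by positivity)
          (pow_le_one₀ hκ0.le hκ.2.le) (Nat.le_add_left d y)) hD
      linarith [hh (y + d)]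
    calc (κ ^ (y + d))⁻¹ * |h (y + d) - u d| * κ ^ y
        ≤ (κ ^ (y + d))⁻¹ * (2 * D * (κ ^ 2) ^ d) * κ ^ y := by gcongr
      _ = 2 * D * κ ^ d := by
        rw [pow_add, ← pow_mul, mul_comm 2 d, mul_two, pow_add]
        field_simp
      _ ≤ (1 + 2 * D) * κ ^ d := mul_le_mul_of_nonneg_right (by linarith) (by positivity)

section

variable {Ω : Type*} [MeasurableSpace Ω] {μ : Measure Ω} [IsProbabilityMeasure μ]

theorem hasSum_measureReal_eq {ξ : Ω → ℕ+} (hξ : Measurable ξ) :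
    HasSum (fun n : ℕ => μ.real {ω | (ξ ω : ℕ) = n}) 1 := by
  have hm : ∀ n : ℕ, MeasurableSet {ω | (ξ ω : ℕ) = n} := fun n =>
    hξ (MeasurableSet.of_discrete (s := {m : ℕ+ | (m : ℕ) = n}))
  have h1 : ∑' n : ℕ, μ {ω | (ξ ω : ℕ) = n} = 1 := by
    rw [← measure_iUnion (fun i j hij => Set.disjoint_left.2 fun ω ha hb => hij (ha.symm.trans hb))
      hm, ← measure_univ (μ := μ)]
    congr 1
    ext ω
    simp
  have h2 := ENNReal.hasSum_toReal (f := fun n : ℕ => μ {ω | (ξ ω : ℕ) = n}) (by simp [h1])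
  rwa [← ENNReal.tsum_toReal_eq fun n => measure_ne_top _ _, h1, ENNReal.toReal_one] at h2

theorem ExponentialTails.exists_le {ξ : Ω → ℕ+} (h : ExponentialTails μ ξ) :
    ∃ C r : ℝ, 0 < r ∧ r < 1 ∧ ∀ n : ℕ, μ.real {ω | (ξ ω : ℕ) = n} ≤ C * r ^ n := by
  obtain ⟨r, hr, h⟩ := h
  obtain ⟨M, hM⟩ := eventually_atTop.1 h
  have hr0 := hr.1
  -- This constant makes the bound at least `1` below the threshold `M`, where nothing is assumed.
  refine ⟨(r ^ (M : ℕ))⁻¹, r, hr.1, hr.2, fun n => ?_⟩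
  rcases le_or_gt (M : ℕ) n with hn | hn
  · have h1 := hM ⟨n, M.pos.trans_le hn⟩ hn
    have h2 : {ω | (ξ ω : ℕ) = n} = {ω | ξ ω = ⟨n, M.pos.trans_le hn⟩} := by
      ext ω
      exact PNat.coe_inj (n := ⟨n, M.pos.trans_le hn⟩)
    rw [h2]
    refine h1.trans (le_mul_of_one_le_left (by positivity) ?_)
    exact (one_le_inv₀ (by positivity)).2 (pow_le_one₀ hr0.le hr.2.le)
  · refine measureReal_le_one.trans ?_
    rw [inv_mul_eq_div, one_le_div (by positivity)]
    exact pow_le_pow_of_le_one hr0.le hr.2.le hn.le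

theorem IsAperiodic.exists_not_dvd {ξ : Ω → ℕ+} (hξ : Measurable ξ) (h : IsAperiodic μ ξ)
    (N : ℕ) (hN : 2 ≤ N) : ∃ n : ℕ, μ.real {ω | (ξ ω : ℕ) = n} ≠ 0 ∧ ¬ N ∣ n := by
  by_contra! hc
  have hm : MeasurableSet {ω | N ∣ (ξ ω : ℕ)} :=
    hξ (MeasurableSet.of_discrete (s := {m : ℕ+ | N ∣ (m : ℕ)}))
  have h0 : μ {ω | N ∣ (ξ ω : ℕ)}ᶜ = 0 := by
    have : {ω | N ∣ (ξ ω : ℕ)}ᶜ ⊆ ⋃ n ∈ {n : ℕ | ¬ N ∣ n}, {ω | (ξ ω : ℕ) = n} := fun ω hω =>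
      Set.mem_biUnion (x := (ξ ω : ℕ)) hω rfl
    refine measure_mono_null this ((measure_biUnion_null_iff (Set.to_countable _)).2 fun n hn => ?_)
    by_contra hne
    exact hn (hc n (by rwa [Ne, measureReal_eq_zero_iff]))
  have h1 := (prob_compl_eq_zero_iff hm).1 h0
  have := h N hN
  rw [measureReal_def, h1, ENNReal.toReal_one] at this
  exact lt_irrefl _ this

end

theorem theorem4p1 {𝕜 : Type*} [RCLike 𝕜]
    {Ω : Type*} [MeasurableSpace Ω] (μ : Measure Ω) [IsProbabilityMeasure μ]
    (ξ : ℕ → Ω → ℕ+) (hξ : IsDelayedRenewalSequence μ ξ)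
    (h_aperiodic : IsAperiodic μ (ξ 1))
    (h_tail_zero : ExponentialTails μ (ξ 0)) (h_tail_one : ExponentialTails μ (ξ 1))
    (p q : ℕ+ → I) :
    ∃ K : Matrix ℕ+ ℕ+ 𝕜,
      IsCorrelationKernel (bernoulliNoise (renewalProcess μ ξ) p q) K ∧
      RepresentsBoundedOperator K := by
  obtain ⟨C₀, r₀, hr₀, hr₀', hC₀⟩ := h_tail_zero.exists_le
  obtain ⟨C₁, r₁, hr₁, hr₁', hC₁⟩ := h_tail_one.exists_le
  obtain ⟨ρ, hρ, B, c, hB⟩ := exists_renewalSeq_sub_le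
    (f := fun n => μ.real {ω | (ξ 1 ω : ℕ) = n}) (by simp) (fun n => measureReal_nonneg)
    (hasSum_measureReal_eq (hξ.measurable 1)) (h_aperiodic.exists_not_dvd (hξ.measurable 1))
    hr₁ hr₁' hC₁
  obtain ⟨τ, hτ, D, hD, hu, hh⟩ := abs_convolution_sub_le (fun n => measureReal_nonneg)
    (hasSum_measureReal_eq (hξ.measurable 0)) hr₀ hr₀' hC₀ hρ hB
  simp only [← hξ.measureReal_exists_eq] at hh
  set κ := √τ with hκdef
  have hκτ : κ ^ 2 = τ := Real.sq_sqrt hτ.1.le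
  have hκ : κ ∈ Set.Ioo (0 : ℝ) 1 :=
    ⟨Real.sqrt_pos.2 hτ.1, by rw [hκdef, Real.sqrt_lt' one_pos]; simpa using hτ.2⟩
  rw [← hκτ] at hu hh
  have hκ0 := hκ.1
  have hK := (hξ.isCorrelationKernel.conj (a := fun x : ℕ+ => (κ ^ (x : ℕ))⁻¹)
    fun x => by positivity).map_ofReal 𝕜
  -- In `C`, the first `1` covers the diagonal term `q x ≤ 1`; `1 + 2 * D` comes from the conjugated
  -- kernel, whose factor satisfies `|1 - p - q| ≤ 1`.
  refine ⟨_, hK.bernoulliNoise p q, RepresentsBoundedOperator.of_exponential_decay _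
    (C := 1 + (1 + 2 * D)) hκ.1.le hκ.2 fun x y => ?_⟩
  have hb := abs_conj_kernel_le hκ hD hh hu (fun n => ⟨measureReal_nonneg, measureReal_le_one⟩) x y
  rw [Matrix.of_apply, add_mul]
  refine (norm_add_le _ _).trans (add_le_add ?_ ?_)
  · split_ifs with hxy
    · subst hxy
      rw [RCLike.norm_ofReal, abs_of_nonneg (q x).2.1]
      simpa using (q x).2.2
    · rw [norm_zero]
      positivity
  · rw [norm_mul, RCLike.norm_ofReal, Matrix.of_apply, RCLike.norm_ofReal]
    have h1 : |1 - (p x : ℝ) - q x| ≤ 1 := by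
      rw [abs_le]
      constructor <;> linarith [(p x).2.1, (p x).2.2, (q x).2.1, (q x).2.2]
    exact (mul_le_of_le_one_left (abs_nonneg _) h1).trans hb
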